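/- Label the vertices of a convex $n$-gon ($n\ge 3$) counterclockwise by $1,\dots,n$, with $n+1$ read as $1$ and $0$ read as $n$. A *3d-dissection* of the $n$-gon is a partition of it into sub-polygons by pairwise non-crossing diagonals such that the number of vertices of every sub-polygon is a multiple of $3$. Its *Ovsienko index* $\mathfrak i$ is the number of sub-polygons with an even number of vertices; the 3d-dissection is *even* or *odd* according to the parity of $\mathfrak i$. Its *quiddity sequence* is $(a_1,\dots,a_n)$, where $a_i$ is the number of sub-polygons having $i$ as a vertex. For integers $a_1,\dots,a_N$ put $$M(a_1,\dots,a_N)=\begin{pmatrix}a_N&-1\\1&0\end{pmatrix}\cdots\begin{pmatrix}a_1&-1\\1&0\end{pmatrix}.$$ Let $S$ be a 3d-dissection of an $n$-gon with quiddity sequence $(s_1,\dots,s_n)$ and $T$ a 3d-dissection of an $m$-gon with quiddity sequence $(t_1,\dots,t_m)$. For $1\le k\le n$ define two dissections of an $(n+m-1)$-gon, labelled starting from vertex $1$ of the $n$-gon: * $S\circ_k T$: identify vertex $k$ of the $n$-gon with vertex $1$ of the $m$-gon and join vertex $k+1$ of the $n$-gon to vertex $m$ of the $m$-gon by a new side;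 the diagonals are those of $S$ and of $T$, the side $(k,k+1)$ of the $n$-gon and the side $(m,1)$ of the $m$-gon. * $S\bullet_k T$: identify vertex $k$ of the $n$-gon with vertex $1$ of the $m$-gon and join vertex $k-1$ of the $n$-gon to vertex $2$ of the $m$-gon by a new side; the diagonals are those of $S$ and of $T$, the side $(k-1,k)$ of the $n$-gon and the side $(1,2)$ of the $m$-gon. **Theorem.** Suppose that $S$ and $T$ are both even or both odd. Then for every $k=1,\dots,n$ the following hold. 1. $S\circ_k T$ and $S\bullet_k T$ are even 3d-dissections of an $(n+m-1)$-gon, and $\mathfrak i(S\circ_kT)=\mathfrak i(S\bullet_kT)=\mathfrak i(S)+\mathfrak i(T)$. 2. The quiddity sequence of $S\circ_k T$ is $$(s_1,\dots,s_{k-1},\,s_k+t_1+1,\,t_2,\dots,t_{m-1},\,t_m+1,\,s_{k+1}+1,\,s_{k+2},\dots,s_n)$$ if $k<n$, and $(s_1+1,s_2,\dots,s_{n-1},s_n+t_1+1,t_2,\dots,t_{m-1},t_m+1)$ if $k=n$. The quiddity sequence of $S\bullet_k T$ is $$(s_1,\dots,s_{k-2},\,s_{k-1}+1,\,t_2+1,\,t_3,\dots,t_m,\,s_k+t_1+1,\,s_{k+1},\dots,s_n)$$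 if $k>1$, and $(s_1+t_1+1,s_2,\dots,s_{n-1},s_n+1,t_2+1,t_3,\dots,t_m)$ if $k=1$. 3. Both of these sequences are solutions, in positive integers, of the equation $M(a_1,\dots,a_{n+m-1})=-\mathrm{Id}$. This gives $2n$ solutions of length $n+m-1$, indexed by the two products and by $k=1,\dots,n$. The $n$ solutions coming from the products $\circ_k$ are pairwise distinct, and so are the $n$ solutions coming from the products $\bullet_k$ (a solution of the first family may coincide with one of the second). -/

import Mathlib

/-! The vertices of a convex `n`-gon are labelled counterclockwise by `1, …, n`.  A dissection is
given by the finite set of diagonals that cut the polygon, a diagonal being an unordered pair of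
labels. -/

namespace ThreeD

/-- The vertex that follows `a` in the `n`-gon; vertex `n + 1` is vertex `1`. -/
def next (n a : ℕ) : ℕ := if a = n then 1 else a + 1

/-- The vertex that precedes `a` in the `n`-gon; vertex `0` is vertex `n`. -/
def prev (n a : ℕ) : ℕ := if a = 1 then n else a - 1

/-- `a` and `b` are the endpoints of a side of the `n`-gon. -/
def IsSide (n a b : ℕ) : Prop := next n a = b ∨ next n b = a

instance (n a b : ℕ) : Decidable (IsSide n a b) := by unfold IsSide; infer_instance

/-- `D` is a set of pairwise non-crossing diagonals of a convex `n`-gon. -/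
structure IsDissection (n : ℕ) (D : Finset (Sym2 ℕ)) : Prop where
  three_le : 3 ≤ n
  diagonal : ∀ a b, s(a, b) ∈ D →
    a ∈ Finset.Icc 1 n ∧ b ∈ Finset.Icc 1 n ∧ a ≠ b ∧ ¬ IsSide n a b
  noncrossing : ∀ a b c d, a < b → b < c → c < d → ¬ (s(a, c) ∈ D ∧ s(b, d) ∈ D)

/-- `a` and `b` are neighbours in the convex polygon with vertex set `P`: one of the two open arcs
that `a` and `b` cut out of the circle contains no vertex of `P`. -/
def Consecutive (P : Finset ℕ) (a b : ℕ) : Prop :=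
  (∀ c ∈ P, ¬ (min a b < c ∧ c < max a b)) ∨ (∀ c ∈ P, min a b ≤ c ∧ c ≤ max a b)

instance (P : Finset ℕ) (a b : ℕ) : Decidable (Consecutive P a b) := by
  unfold Consecutive; infer_instance

/-- `P` is the vertex set of a sub-polygon of the dissection `D` of the `n`-gon: two vertices of `P`
are joined by a side of the `n`-gon or by a diagonal in `D` exactly when they are neighbours in `P`
(so the boundary of the polygon `P` is drawn, and no diagonal in `D` cuts it further). -/
def IsSubPolygon (n : ℕ) (D : Finset (Sym2 ℕ)) (P : Finset ℕ) : Prop :=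
  3 ≤ P.card ∧ ∀ a ∈ P, ∀ b ∈ P, a ≠ b → ((IsSide n a b ∨ s(a, b) ∈ D) ↔ Consecutive P a b)

instance (n : ℕ) (D : Finset (Sym2 ℕ)) (P : Finset ℕ) : Decidable (IsSubPolygon n D P) := by
  unfold IsSubPolygon; infer_instance

/-- The sub-polygons of the dissection `D`, each given by its set of vertices. -/
def subPolygons (n : ℕ) (D : Finset (Sym2 ℕ)) : Finset (Finset ℕ) :=
  (Finset.Icc 1 n).powerset.filter (IsSubPolygon n D)

/-- A 3d-dissection: the number of vertices of every sub-polygon is a multiple of `3`. -/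
def Is3dDissection (n : ℕ) (D : Finset (Sym2 ℕ)) : Prop :=
  IsDissection n D ∧ ∀ P ∈ subPolygons n D, 3 ∣ P.card

/-- The Ovsienko index: the number of sub-polygons with an even number of vertices. -/
def index (n : ℕ) (D : Finset (Sym2 ℕ)) : ℕ :=
  ((subPolygons n D).filter (fun P => Even P.card)).card

/-- An even 3d-dissection of the `n`-gon. -/
def IsEven3d (n : ℕ) (D : Finset (Sym2 ℕ)) : Prop := Is3dDissection n D ∧ Even (index n D)

/-- An odd 3d-dissection of the `n`-gon. -/
def IsOdd3d (n : ℕ) (D : Finset (Sym2 ℕ)) : Prop := Is3dDissection n D ∧ Odd (index n D)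

/-- The quiddity sequence `(a₁, …, aₙ)`: `aᵢ` is the number of sub-polygons at vertex `i`. -/
def quiddity (n : ℕ) (D : Finset (Sym2 ℕ)) : List ℕ :=
  (List.range' 1 n).map (fun i => ((subPolygons n D).filter (fun P => i ∈ P)).card)

/-- Relabelling of the vertices of a polygon when `m - 1` new vertices are inserted right after
vertex `j`. -/
def shift (m j i : ℕ) : ℕ := if i ≤ j then i else i + (m - 1)

/-- The product `S ∘ₖ T` of dissections of an `n`-gon and an `m`-gon: vertex `1` of the second
polygon is put on vertex `k` of the first, and vertex `m` of the second is joined to vertex `k + 1`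
of the first.  The diagonals are the old ones, the side `(k, k + 1)` of the first polygon and the
side `(m, 1)` of the second.  Labels start at vertex `1` of the first polygon; vertex `i` of the
second polygon gets the label `k + i - 1`. -/
def circ (n m k : ℕ) (S T : Finset (Sym2 ℕ)) : Finset (Sym2 ℕ) :=
  S.image (Sym2.map (shift m k)) ∪ T.image (Sym2.map (fun i => k + i - 1)) ∪
    {s(shift m k k, shift m k (next n k)), s(k, k + m - 1)}

/-- The label in `S •ₖ T` of vertex `i` of the second polygon: vertex `1` lies on vertex `k` of the
first polygon, the others follow vertex `k - 1` of the first polygon. -/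
def bulletLabel (n m k i : ℕ) : ℕ :=
  if i = 1 then shift m (prev n k) k else prev n k + i - 1

/-- The product `S •ₖ T`: vertex `1` of the second polygon is put on vertex `k` of the first, and
vertex `2` of the second is joined to vertex `k - 1` of the first.  The diagonals are the old
ones, the side `(k - 1, k)` of the first polygon and the side `(1, 2)` of the second. -/
def bullet (n m k : ℕ) (S T : Finset (Sym2 ℕ)) : Finset (Sym2 ℕ) :=
  S.image (Sym2.map (shift m (prev n k))) ∪ T.image (Sym2.map (bulletLabel n m k)) ∪
    {s(shift m (prev n k) (prev n k), shift m (prev n k) k),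
      s(bulletLabel n m k 1, bulletLabel n m k 2)}

/-- The product `s ∘ₖ t` of sequences `s = (s₁, …, sₙ)` and `t = (t₁, …, tₘ)`,
`(s₁, …, sₖ₋₁, sₖ + t₁ + 1, t₂, …, tₘ₋₁, tₘ + 1, sₖ₊₁ + 1, sₖ₊₂, …, sₙ)` for `k < n` and
`(s₁ + 1, s₂, …, sₙ₋₁, sₙ + t₁ + 1, t₂, …, tₘ₋₁, tₘ + 1)` for `k = n`.  (`List.modify` counts
positions from `0`.) -/
def circSeq (k : ℕ) (s t : List ℕ) : List ℕ :=
  let s' := (s.modify (k - 1) (· + t.headD 0 + 1)).modify (next s.length k - 1) (· + 1)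
  s'.take k ++ t.tail.modify (t.length - 2) (· + 1) ++ s'.drop k

/-- The product `s •ₖ t` of sequences `s = (s₁, …, sₙ)` and `t = (t₁, …, tₘ)`,
`(s₁, …, sₖ₋₂, sₖ₋₁ + 1, t₂ + 1, t₃, …, tₘ, sₖ + t₁ + 1, sₖ₊₁, …, sₙ)` for `k > 1` and
`(s₁ + t₁ + 1, s₂, …, sₙ₋₁, sₙ + 1, t₂ + 1, t₃, …, tₘ)` for `k = 1`. -/
def bulletSeq (k : ℕ) (s t : List ℕ) : List ℕ :=
  let j := prev s.length k
  let s' := (s.modify (k - 1) (· + t.headD 0 + 1)).modify (j - 1) (· + 1)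
  s'.take j ++ t.tail.modify 0 (· + 1) ++ s'.drop j

/-- `M(a₁, …, aₙ) = M(aₙ) ⋯ M(a₁)` with `M(a) = (a, -1; 1, 0)`. -/
def M (a : List ℤ) : Matrix (Fin 2) (Fin 2) ℤ :=
  (a.reverse.map (fun x => !![x, -1; 1, 0])).prod

/-- `a = (a₁, …, a_N)` is a solution of `M(a₁, …, a_N) = -Id` in positive integers. -/
def IsPositiveSolution (N : ℕ) (a : List ℕ) : Prop :=
  a.length = N ∧ (∀ x ∈ a, 0 < x) ∧ M (a.map (fun x => (x : ℤ))) = -1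

end ThreeD

/-! A dissection with more than one sub-polygon is cut by a diagonal into two smaller ones, so its
properties follow by induction from those of a single polygon.  With `step x` the factor
`(x, -1; 1, 0)`, one has `step (x + y) = -(step x * step 0 * step y)`.  Hence cutting along a
diagonal multiplies the monodromies of the two parts with one sign, and since `step 1 ^ 3 = -1`, a
3d-dissection has `M = (-1) ^ (index + 1)`.

In both products the two polygons share a vertex, and a neighbour of it in one polygon is joined to
a neighbour in the other.  So the sub-polygons of the product are those of the factors and one new
triangle, which leaves the index unchanged and adds `1` to the quiddity at its three corners.  At
the shared vertex the quiddity grows by `t₁ + 1 ≥ 2`, at every other vertex of the first polygon by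
at most `1`; this tells the products for different `k` apart. -/

namespace ThreeD

attribute [local instance] LinearOrder.toCircularOrder

section Crosses

variable {α : Type*} [CircularOrder α] {a b c d e : α}

theorem sbtw_ne (h : sbtw a b c) : b ≠ a ∧ b ≠ c :=
  ⟨by rintro rfl; exact sbtw_irrefl_left h, by rintro rfl; exact sbtw_irrefl_right h⟩

theorem sbtw_or_sbtw (hab : a ≠ b) (hca : c ≠ a) (hcb : c ≠ b) : sbtw a c b ∨ sbtw b c a := by
  by_contra! h
  rcases (btw_iff_not_sbtw.2 h.2).antisymm (btw_iff_not_sbtw.2 h.1) with h | h | h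
  exacts [hca h.symm, hcb h, hab h.symm]

/-- The chords `ab` and `cd` of a circle cross: `c` and `d` lie in different open arcs between
`a` and `b`.  In particular the four endpoints are distinct. -/
def Crosses (a b c d : α) : Prop :=
  sbtw a c b ∧ sbtw b d a ∨ sbtw a d b ∧ sbtw b c a

theorem Crosses.swap_right (h : Crosses a b c d) : Crosses a b d c := Or.symm h

theorem Crosses.swap_left (h : Crosses a b c d) : Crosses b a c d :=
  Or.symm (h.imp And.symm And.symm)

theorem Crosses.symm (h : Crosses a b c d) : Crosses c d a b := by
  have arc : ∀ {x y : α}, sbtw a x b → sbtw b y a → sbtw x b y ∧ sbtw y a x := fun hx hy =>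
    ⟨(hy.cyclic_left.trans_left hx).cyclic_left, (hx.cyclic_left.trans_left hy).cyclic_left⟩
  exact h.elim (fun h => Or.inr (arc h.1 h.2)) fun h => Or.inl (arc h.1 h.2).symm

theorem Crosses.ne_left (h : Crosses a b c d) : c ≠ a ∧ c ≠ b :=
  h.elim (fun h => sbtw_ne h.1) fun h => (sbtw_ne h.2).symm

theorem Crosses.ne_right (h : Crosses a b c d) : d ≠ a ∧ d ≠ b := h.swap_right.ne_left

theorem Crosses.ne (h : Crosses a b c d) : a ≠ b := by
  rintro rfl
  exact h.elim (fun h => sbtw_irrefl_left_right h.1) fun h => sbtw_irrefl_left_right h.1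

theorem Crosses.or_of_ne (h : Crosses a b c d) (hea : e ≠ a) (heb : e ≠ b) :
    Crosses a b c e ∨ Crosses a b d e := by
  rcases sbtw_or_sbtw h.ne hea heb with he | he <;> rcases h with ⟨hc, hd⟩ | ⟨hd, hc⟩
  exacts [Or.inr (Or.inr ⟨he, hd⟩), Or.inl (Or.inr ⟨he, hc⟩), Or.inl (Or.inl ⟨hc, he⟩),
    Or.inr (Or.inl ⟨hd, he⟩)]

theorem Crosses.not_crosses (hd : Crosses a b c d) (he : Crosses a b c e) :
    ¬ Crosses a b d e := by
  have asymm : ∀ {x : α}, sbtw a x b → ¬ sbtw b x a := fun h h' => h.not_sbtw h'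
  rcases hd with ⟨hc, hd⟩ | ⟨hd, hc⟩ <;> rcases he with ⟨hc', he⟩ | ⟨he, hc'⟩ <;>
    rintro (⟨h, h'⟩ | ⟨h, h'⟩) <;> simp_all

theorem crosses_or_crosses_or_crosses (hab : a ≠ b) (hac : a ≠ c) (had : a ≠ d) (hbc : b ≠ c)
    (hbd : b ≠ d) (hcd : c ≠ d) : Crosses a b c d ∨ Crosses a c b d ∨ Crosses a d b c := by
  rcases sbtw_or_sbtw hab hac.symm hbc.symm with hc | hc <;>
    rcases sbtw_or_sbtw hab had.symm hbd.symm with hd | hd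
  · rcases sbtw_or_sbtw hac had.symm hcd.symm with h | h
    · exact Or.inr (Or.inl (Or.inr ⟨h, hc.cyclic_left⟩))
    · exact Or.inr (Or.inr (Or.inr ⟨h.cyclic_right, hd.cyclic_left⟩))
  · exact Or.inl (Or.inl ⟨hc, hd⟩)
  · exact Or.inl (Or.inr ⟨hd, hc⟩)
  · rcases sbtw_or_sbtw hac had.symm hcd.symm with h | h
    · exact Or.inr (Or.inr (Or.inl ⟨hd.cyclic_right, h.cyclic_left⟩))
    · exact Or.inr (Or.inl (Or.inl ⟨hc.cyclic_right, h⟩))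

end Crosses

section Consecutive

variable {P : Finset ℕ} {a b c d : ℕ}

theorem sbtw_iff_lt : sbtw a b c ↔ a < b ∧ b < c ∨ b < c ∧ c < a ∨ c < a ∧ a < b := Iff.rfl

theorem crosses_iff_lt : Crosses a b c d ↔
    ((min a b < c ∧ c < max a b) ∧ (d < min a b ∨ max a b < d)) ∨
    ((min a b < d ∧ d < max a b) ∧ (c < min a b ∨ max a b < c)) := by
  simp only [Crosses, sbtw_iff_lt]
  rcases le_total a b with h | h
  · simp only [min_eq_left h, max_eq_right h]
    omega
  · simp only [min_eq_right h, max_eq_left h]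
    omega

theorem crosses_iff_of_lt (hab : a < b) : Crosses a b c d ↔
    (c ∈ Finset.Ioo a b ∧ d ∉ Finset.Icc a b) ∨ (d ∈ Finset.Ioo a b ∧ c ∉ Finset.Icc a b) := by
  simp only [crosses_iff_lt, min_eq_left hab.le, max_eq_right hab.le, Finset.mem_Ioo,
    Finset.mem_Icc]
  omega

theorem consecutive_iff : Consecutive P a b ↔ ∀ c ∈ P, ∀ d ∈ P, ¬ Crosses a b c d := by
  simp only [Consecutive, crosses_iff_lt]
  constructor
  · rintro (h | h) c hc d hd hcross
    · have := h c hc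
      have := h d hd
      tauto
    · have := h c hc
      have := h d hd
      omega
  · intro h
    by_contra! hP
    obtain ⟨⟨c, hc, hcab⟩, d, hd, hdab⟩ := hP
    exact h c hc d hd (Or.inl ⟨hcab, by omega⟩)

theorem exists_forall_crosses {x : ℕ} (hP : 1 < P.card) (hx : x ∉ P) :
    ∃ c ∈ P, ∃ d ∈ P, c ≠ d ∧ ∀ y ∈ P, y ≠ c → y ≠ d → Crosses c d x y := by
  have hne : ∀ y ∈ P, y ≠ x := fun y hy h => hx (h ▸ hy)
  by_cases hsides : (P.filter (· < x)).Nonempty ∧ (P.filter (x < ·)).Nonempty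
  · obtain ⟨c, hc, hmax⟩ := Finset.exists_max_image _ id hsides.1
    obtain ⟨d, hd, hmin⟩ := Finset.exists_min_image _ id hsides.2
    simp only [Finset.mem_filter, and_imp, id] at hc hd hmax hmin
    refine ⟨c, hc.1, d, hd.1, by omega, fun y hy hyc hyd => Or.inl ?_⟩
    have := hne y hy
    have := hmax y hy
    have := hmin y hy
    simp only [sbtw_iff_lt]
    omega
  · have hPne := Finset.card_pos.1 (by omega : 0 < P.card)
    have hc := P.max'_mem hPne
    have hd := P.min'_mem hPne
    have hdc := P.min'_lt_max'_of_card hP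
    have hx : x < P.min' hPne ∨ P.max' hPne < x := by
      by_contra! h
      exact hsides ⟨⟨_, Finset.mem_filter.2 ⟨hd, h.1.lt_of_ne (hne _ hd)⟩⟩,
        ⟨_, Finset.mem_filter.2 ⟨hc, h.2.lt_of_ne (hne _ hc).symm⟩⟩⟩
    refine ⟨_, hc, _, hd, hdc.ne', fun y hy hyc hyd => Or.inl ⟨?_, ?_⟩⟩
    · simp only [sbtw_iff_lt]
      omega
    · exact Or.inl ⟨(P.min'_le y hy).lt_of_ne hyd.symm, (P.le_max' y hy).lt_of_ne hyc⟩

theorem exists_consecutive_forall_crosses {x : ℕ} (hP : 1 < P.card) (hx : x ∉ P) :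
    ∃ c ∈ P, ∃ d ∈ P, c ≠ d ∧ Consecutive P c d ∧
      ∀ y ∈ P, y ≠ c → y ≠ d → Crosses c d x y := by
  obtain ⟨c, hc, d, hd, hcd, hcross⟩ := exists_forall_crosses hP hx
  refine ⟨c, hc, d, hd, hcd, consecutive_iff.2 fun y hy z hz h => ?_, hcross⟩
  exact (hcross y hy h.ne_left.1 h.ne_left.2).not_crosses
    (hcross z hz h.ne_right.1 h.ne_right.2) h

theorem Crosses.mem_Ioo_or_mem_Ioo {x y : ℕ} (h : Crosses a b x y) (ha : a ∈ Finset.Icc c d)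
    (hb : b ∈ Finset.Icc c d) : x ∈ Finset.Ioo c d ∨ y ∈ Finset.Ioo c d := by
  rw [crosses_iff_lt] at h
  simp only [Finset.mem_Icc, Finset.mem_Ioo] at *
  omega

end Consecutive

section Faces

variable {E : ℕ → ℕ → Prop} {V P : Finset ℕ} {a b : ℕ}

/-- `P` is the vertex set of a face of the drawing in which `a` and `b` are joined when `E a b`:
the edges between vertices of `P` are exactly the sides of the polygon `P`. -/
def IsFace (E : ℕ → ℕ → Prop) (P : Finset ℕ) : Prop :=
  3 ≤ P.card ∧ ∀ a ∈ P, ∀ b ∈ P, a ≠ b → (E a b ↔ Consecutive P a b)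

open Classical in
/-- The faces with all vertices in `V`. -/
noncomputable def faces (E : ℕ → ℕ → Prop) (V : Finset ℕ) : Finset (Finset ℕ) :=
  V.powerset.filter (IsFace E)

/-- The number of faces with all vertices in `V` that satisfy `p`. -/
noncomputable def faceCount (E : ℕ → ℕ → Prop) (V : Finset ℕ) (p : Finset ℕ → Prop)
    [DecidablePred p] : ℕ :=
  ((faces E V).filter p).card

/-- The number of faces with all vertices in `V` at the vertex `i`. -/
noncomputable def vertexDegree (E : ℕ → ℕ → Prop) (V : Finset ℕ) (i : ℕ) : ℕ :=
  faceCount E V (i ∈ ·)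

/-- The number of faces with all vertices in `V` that have an even number of vertices. -/
noncomputable def evenFaces (E : ℕ → ℕ → Prop) (V : Finset ℕ) : ℕ :=
  faceCount E V (Even ·.card)

theorem mem_faces : P ∈ faces E V ↔ P ⊆ V ∧ IsFace E P := by
  simp [faces]

theorem faceCount_congr {p q : Finset ℕ → Prop} [DecidablePred p] [DecidablePred q]
    (h : ∀ P ⊆ V, (p P ↔ q P)) : faceCount E V p = faceCount E V q := by
  rw [faceCount, faceCount, Finset.filter_congr fun P hP => h P (mem_faces.1 hP).1]

theorem vertexDegree_eq_zero (ha : a ∉ V) : vertexDegree E V a = 0 :=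
  Finset.card_eq_zero.2 <| Finset.filter_eq_empty_iff.2 fun _ hP haP =>
    ha ((mem_faces.1 hP).1 haP)

theorem IsFace.exists_ne_ne (hP : IsFace E P) (a b : ℕ) : ∃ c ∈ P, c ≠ a ∧ c ≠ b := by
  obtain ⟨c, hc, hcab⟩ := Finset.exists_mem_notMem_of_card_lt_card
    (Finset.card_le_two.trans_lt hP.1 : ({a, b} : Finset ℕ).card < P.card)
  exact ⟨c, hc, by simpa [not_or] using hcab⟩

theorem IsFace.faces_eq_singleton (hV : IsFace E V) : faces E V = {V} := by
  refine Finset.eq_singleton_iff_unique_mem.2 ⟨mem_faces.2 ⟨subset_rfl, hV⟩, fun P hP => ?_⟩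
  obtain ⟨hPV, hP⟩ := mem_faces.1 hP
  refine hPV.antisymm fun x hxV => ?_
  by_contra hx
  obtain ⟨c, hc, d, hd, hcd, hcons, hcross⟩ :=
    exists_consecutive_forall_crosses (by have := hP.1; omega) hx
  obtain ⟨y, hy, hyc, hyd⟩ := hP.exists_ne_ne c d
  have hcV := (hV.2 c (hPV hc) d (hPV hd) hcd).1 ((hP.2 c hc d hd hcd).2 hcons)
  exact consecutive_iff.1 hcV x hxV y (hPV hy) (hcross y hy hyc hyd)

/-- If `a` is not a vertex of `P`, the side of `P` that separates `a` from `P` crosses `ab`. -/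
theorem IsFace.mem_of_crosses (hP : IsFace E P) {x y : ℕ}
    (hnc : ∀ c ∈ P, ∀ d ∈ P, E c d → ¬ Crosses a b c d) (hx : x ∈ P) (hy : y ∈ P)
    (hxy : Crosses a b x y) : a ∈ P := by
  by_contra ha
  obtain ⟨c, hc, d, hd, hcd, hcons, hcross⟩ :=
    exists_consecutive_forall_crosses (by have := hP.1; omega) ha
  have hab := mt Crosses.symm (hnc c hc d hd ((hP.2 c hc d hd hcd).2 hcons))
  have hac : a ≠ c := fun h => ha (h ▸ hc)
  have had : a ≠ d := fun h => ha (h ▸ hd)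
  have hside : ∀ z ∈ P, z ∈ Finset.Ioo (min c d) (max c d) ↔
      z ≠ c ∧ z ≠ d ∧ a ∉ Finset.Icc (min c d) (max c d) := by
    intro z hz
    have := hcross z hz
    rw [crosses_iff_lt] at this
    simp only [Finset.mem_Icc, Finset.mem_Ioo]
    omega
  rw [crosses_iff_lt] at hab
  have hxside := hside x hx
  have hyside := hside y hy
  by_cases hinner : a ∈ Finset.Icc (min c d) (max c d)
  · have := hxy.mem_Ioo_or_mem_Ioo hinner (by simp only [Finset.mem_Icc] at *; omega)
    tauto
  · have := hxy.symm.mem_Ioo_or_mem_Ioo (c := min c d) (d := max c d)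
    simp only [Finset.mem_Icc, Finset.mem_Ioo] at *
    omega

theorem IsFace.consecutive_of_not_crosses (hP : IsFace E P) (hab : a ≠ b) (hE : E a b)
    (hnc : ∀ c ∈ P, ∀ d ∈ P, E c d → ¬ Crosses a b c d) : Consecutive P a b := by
  refine consecutive_iff.2 fun x hx y hy hxy => ?_
  have ha := hP.mem_of_crosses hnc hx hy hxy
  have hb := hP.mem_of_crosses (fun c hc d hd hcd h => hnc c hc d hd hcd h.swap_left) hx hy
    hxy.swap_left
  exact consecutive_iff.1 ((hP.2 a ha b hb hab).1 hE) x hx y hy hxy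

end Faces

section Cuts

variable {E : ℕ → ℕ → Prop} {V V₁ V₂ P : Finset ℕ} {a b x y : ℕ}

/-- The edges of the drawing contain the sides of the polygon `V`, and they do not cross inside
it. -/
structure IsPlanar (E : ℕ → ℕ → Prop) (V : Finset ℕ) : Prop where
  symm : ∀ ⦃a b⦄, E a b → E b a
  not_crosses : ∀ a ∈ V, ∀ b ∈ V, ∀ c ∈ V, ∀ d ∈ V, E a b → E c d → ¬ Crosses a b c d
  side : ∀ a ∈ V, ∀ b ∈ V, a ≠ b → Consecutive V a b → E a b

/-- The chord `ab` cuts the polygon `V` into the polygons `V₁` and `V₂`. -/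
structure IsCut (V V₁ V₂ : Finset ℕ) (a b : ℕ) : Prop where
  ne : a ≠ b
  union_eq : V₁ ∪ V₂ = V
  inter_eq : V₁ ∩ V₂ = {a, b}
  not_crosses : ∀ x ∈ V₁, ∀ y ∈ V₁, ∀ z ∈ V₂, ∀ w ∈ V₂, ¬ Crosses x y z w

namespace IsCut

theorem symm (h : IsCut V V₁ V₂ a b) : IsCut V V₂ V₁ a b where
  ne := h.ne
  union_eq := by rw [Finset.union_comm, h.union_eq]
  inter_eq := by rw [Finset.inter_comm, h.inter_eq]
  not_crosses x hx y hy z hz w hw hc := h.not_crosses z hz w hw x hx y hy hc.symm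

theorem left_subset (h : IsCut V V₁ V₂ a b) : V₁ ⊆ V :=
  h.union_eq ▸ Finset.subset_union_left

theorem mem_inter (h : IsCut V V₁ V₂ a b) : x ∈ V₁ ∧ x ∈ V₂ ↔ x = a ∨ x = b := by
  rw [← Finset.mem_inter, h.inter_eq, Finset.mem_insert, Finset.mem_singleton]

theorem left_mem (h : IsCut V V₁ V₂ a b) : a ∈ V₁ ∧ a ∈ V₂ := h.mem_inter.2 (Or.inl rfl)

theorem right_mem (h : IsCut V V₁ V₂ a b) : b ∈ V₁ ∧ b ∈ V₂ := h.mem_inter.2 (Or.inr rfl)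

theorem mem_or_mem (h : IsCut V V₁ V₂ a b) (hx : x ∈ V) : x ∈ V₁ ∨ x ∈ V₂ :=
  Finset.mem_union.1 (h.union_eq ▸ hx)

theorem crosses (h : IsCut V V₁ V₂ a b) (hx : x ∈ V₁) (hx' : x ∉ V₂)
    (hy : y ∈ V₂) (hy' : y ∉ V₁) : Crosses a b x y := by
  have ⟨ha, ha'⟩ := h.left_mem
  have ⟨hb, hb'⟩ := h.right_mem
  refine (crosses_or_crosses_or_crosses h.ne ?_ ?_ ?_ ?_ ?_).resolve_right ?_
  any_goals rintro rfl; contradiction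
  exact not_or.2 ⟨h.not_crosses a ha x hx b hb' y hy,
    fun hc => h.not_crosses b hb x hx a ha' y hy hc.symm⟩

theorem consecutive_left (h : IsCut V V₁ V₂ a b) (hx : x ∈ V₁) (hy : y ∈ V₁)
    (hxy : Consecutive V₁ x y) : Consecutive V x y ∨ s(x, y) = s(a, b) := by
  rw [or_iff_not_imp_right, consecutive_iff]
  intro hne c hc d hd hcd
  obtain ⟨e, he, hex, hey⟩ : ∃ e, (e ∈ V₁ ∧ e ∈ V₂) ∧ e ≠ x ∧ e ≠ y := by
    by_contra! hxy
    have := hxy a h.left_mem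
    have := hxy b h.right_mem
    have := h.ne
    grind
  rw [consecutive_iff] at hxy
  have key : ∀ c ∈ V₁, ∀ d ∈ V₂, ¬ Crosses x y c d := fun c hc d hd hcd =>
    (hcd.or_of_ne hex hey).elim (hxy c hc e he.1) (h.not_crosses x hx y hy d hd e he.2)
  rcases h.mem_or_mem hc, h.mem_or_mem hd with ⟨hc | hc, hd | hd⟩
  exacts [hxy c hc d hd hcd, key c hc d hd hcd, key d hd c hc hcd.swap_right,
    h.not_crosses x hx y hy c hc d hd hcd]

theorem isPlanar_left (h : IsCut V V₁ V₂ a b) (hV : IsPlanar E V) (hE : E a b) :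
    IsPlanar E V₁ where
  symm := hV.symm
  not_crosses a ha b hb c hc d hd := hV.not_crosses a (h.left_subset ha) b (h.left_subset hb)
    c (h.left_subset hc) d (h.left_subset hd)
  side x hx y hy hxy hcons := by
    rcases h.consecutive_left hx hy hcons with hcons | heq
    · exact hV.side x (h.left_subset hx) y (h.left_subset hy) hxy hcons
    · rcases Sym2.eq_iff.1 heq with ⟨rfl, rfl⟩ | ⟨rfl, rfl⟩
      exacts [hE, hV.symm hE]

theorem subset_or_subset_of_isFace (h : IsCut V V₁ V₂ a b) (hV : IsPlanar E V)
    (hE : E a b) (hPV : P ⊆ V) (hP : IsFace E P) : P ⊆ V₁ ∨ P ⊆ V₂ := by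
  by_contra! hP'
  obtain ⟨⟨y, hy, hy₁⟩, x, hx, hx₂⟩ := hP'.imp Finset.not_subset.1 Finset.not_subset.1
  have hcons := hP.consecutive_of_not_crosses h.ne hE fun c hc d hd =>
    hV.not_crosses a (h.left_subset h.left_mem.1) b (h.left_subset h.right_mem.1)
      c (hPV hc) d (hPV hd) hE
  exact consecutive_iff.1 hcons x hx y hy (h.crosses ((h.mem_or_mem (hPV hx)).resolve_right hx₂)
    hx₂ ((h.mem_or_mem (hPV hy)).resolve_left hy₁) hy₁)

theorem disjoint_faces (h : IsCut V V₁ V₂ a b) : Disjoint (faces E V₁) (faces E V₂) := by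
  refine Finset.disjoint_left.2 fun P hP₁ hP₂ => ?_
  rw [mem_faces] at hP₁ hP₂
  obtain ⟨c, hc, hca, hcb⟩ := hP₁.2.exists_ne_ne a b
  exact (h.mem_inter.1 ⟨hP₁.1 hc, hP₂.1 hc⟩).elim hca hcb

theorem faces_eq (h : IsCut V V₁ V₂ a b) (hV : IsPlanar E V) (hE : E a b) :
    faces E V = faces E V₁ ∪ faces E V₂ := by
  ext P
  simp only [Finset.mem_union, mem_faces, ← or_and_right, and_congr_left_iff]
  exact fun hP => ⟨fun hPV => h.subset_or_subset_of_isFace hV hE hPV hP,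
    Or.rec (·.trans h.left_subset) (·.trans h.symm.left_subset)⟩

theorem faceCount_eq (h : IsCut V V₁ V₂ a b) (hV : IsPlanar E V) (hE : E a b)
    (p : Finset ℕ → Prop) [DecidablePred p] :
    faceCount E V p = faceCount E V₁ p + faceCount E V₂ p := by
  rw [faceCount, h.faces_eq hV hE, Finset.filter_union, Finset.card_union_of_disjoint
    (Finset.disjoint_filter_filter h.disjoint_faces), faceCount, faceCount]

end IsCut

theorem isCut_filter (hab : a < b) (ha : a ∈ V) (hb : b ∈ V) :
    IsCut V (V.filter (· ∈ Finset.Icc a b)) (V.filter (· ∉ Finset.Ioo a b)) a b where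
  ne := hab.ne
  union_eq := by
    ext x
    simp only [Finset.mem_union, Finset.mem_filter, Finset.mem_Icc, Finset.mem_Ioo]
    grind
  inter_eq := by
    ext x
    simp only [Finset.mem_inter, Finset.mem_filter, Finset.mem_Icc, Finset.mem_Ioo,
      Finset.mem_insert, Finset.mem_singleton]
    grind
  not_crosses x hx y hy z hz w hw hc :=
    (hc.mem_Ioo_or_mem_Ioo (Finset.mem_filter.1 hx).2 (Finset.mem_filter.1 hy).2).elim
      (Finset.mem_filter.1 hz).2 (Finset.mem_filter.1 hw).2

theorem IsPlanar.exists_chord (hV : IsPlanar E V) (hcard : 3 ≤ V.card) (hface : ¬ IsFace E V) :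
    ∃ a ∈ V, ∃ b ∈ V, a < b ∧ E a b ∧
      ∃ c ∈ V, ∃ d ∈ V, c ∈ Finset.Ioo a b ∧ d ∉ Finset.Icc a b := by
  obtain ⟨a, ha, b, hb, hab, hE, hcons⟩ :
      ∃ a ∈ V, ∃ b ∈ V, a ≠ b ∧ E a b ∧ ¬ Consecutive V a b := by
    by_contra! h
    exact hface ⟨hcard, fun a ha b hb hab => ⟨h a ha b hb hab, hV.side a ha b hb hab⟩⟩
  simp only [consecutive_iff, not_forall, not_not] at hcons
  obtain ⟨c, hc, d, hd, hcd⟩ := hcons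
  wlog hlt : a < b generalizing a b
  · exact this b hb a ha hab.symm (hV.symm hE) hcd.swap_left (hab.lt_or_gt.resolve_left hlt)
  refine ⟨a, ha, b, hb, hlt, hE, ?_⟩
  rcases (crosses_iff_of_lt hlt).1 hcd with h | h
  exacts [⟨c, hc, d, hd, h⟩, ⟨d, hd, c, hc, h⟩]

theorem IsPlanar.cut_induction {motive : Finset ℕ → Prop}
    (face : ∀ V, IsFace E V → motive V)
    (cut : ∀ V a b, IsPlanar E V → E a b → a < b → a ∈ V → b ∈ V →
      motive (V.filter (· ∈ Finset.Icc a b)) → motive (V.filter (· ∉ Finset.Ioo a b)) → motive V)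
    (hV : IsPlanar E V) (hcard : 3 ≤ V.card) : motive V := by
  induction hN : V.card using Nat.strong_induction_on generalizing V with
  | _ N ih =>
  subst hN
  by_cases hface : IsFace E V
  · exact face V hface
  obtain ⟨a, ha, b, hb, hab, hE, c, hc, d, hd, hcab, hdab⟩ := hV.exists_chord hcard hface
  have hcut := isCut_filter hab ha hb
  have three_le : ∀ {U : Finset ℕ} {x : ℕ}, a ∈ U → b ∈ U → x ∈ U → x ≠ a → x ≠ b → 3 ≤ U.card :=
    fun ha hb hx hxa hxb => Finset.two_lt_card.2 ⟨a, ha, b, hb, _, hx, hab.ne, hxa.symm, hxb.symm⟩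
  simp only [Finset.mem_Icc, Finset.mem_Ioo] at hcab hdab
  refine cut V a b hV hE hab ha hb (ih _ ?_ (hcut.isPlanar_left hV hE) ?_ rfl)
    (ih _ ?_ (hcut.symm.isPlanar_left hV hE) ?_ rfl)
  · exact Finset.card_lt_card (Finset.filter_ssubset.2 ⟨d, hd, by simpa using hdab⟩)
  · exact three_le hcut.left_mem.1 hcut.right_mem.1
      (Finset.mem_filter.2 ⟨hc, Finset.mem_Icc.2 ⟨hcab.1.le, hcab.2.le⟩⟩) (by omega) (by omega)
  · exact Finset.card_lt_card (Finset.filter_ssubset.2 ⟨c, hc, by simpa using hcab⟩)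
  · exact three_le hcut.left_mem.2 hcut.right_mem.2
      (Finset.mem_filter.2 ⟨hd, by simp only [Finset.mem_Ioo]; omega⟩) (by omega) (by omega)

theorem IsPlanar.vertexDegree_pos {i : ℕ} (hV : IsPlanar E V) (hcard : 3 ≤ V.card) (hi : i ∈ V) :
    0 < vertexDegree E V i := by
  revert hi
  refine hV.cut_induction (motive := fun V => i ∈ V → 0 < vertexDegree E V i) ?_ ?_ hcard
  · intro V hface hi
    exact Finset.card_pos.2 ⟨V, Finset.mem_filter.2 ⟨mem_faces.2 ⟨subset_rfl, hface⟩, hi⟩⟩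
  · intro V a b hV hE hab ha hb inner outer hi
    have hcut := isCut_filter hab ha hb
    rw [vertexDegree, hcut.faceCount_eq hV hE]
    exact (hcut.mem_or_mem hi).elim (fun h => Nat.add_pos_left (inner h) _)
      fun h => Nat.add_pos_right _ (outer h)

end Cuts

section Monodromy

theorem M_append (s t : List ℤ) : M (s ++ t) = M t * M s := by
  simp only [M, List.reverse_append, List.map_append, List.prod_append]

/-- The factor of `M(a₁, …, aₙ)` that belongs to an entry `x`. -/
def step (x : ℤ) : Matrix (Fin 2) (Fin 2) ℤ := !![x, -1; 1, 0]

theorem M_cons (x : ℤ) (s : List ℤ) : M (x :: s) = M s * step x := by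
  simp [M, step]

theorem step_add (x y : ℤ) : step (x + y) = -(step x * step 0 * step y) := by
  ext i j
  fin_cases i <;> fin_cases j <;> simp [step]

theorem step_zero_mul_step_zero : step 0 * step 0 = -1 := by decide

theorem step_one_pow_three : step 1 ^ 3 = -1 := by decide

theorem M_replicate (x : ℤ) (n : ℕ) : M (List.replicate n x) = step x ^ n := by
  rw [M, List.reverse_replicate, List.map_replicate, List.prod_replicate, step]

/-- The matrix `M` of the labels `d` of the vertices of the polygon `V`, read in increasing
order. -/
def monodromy (d : ℕ → ℤ) (V : Finset ℕ) : Matrix (Fin 2) (Fin 2) ℤ := M (V.sort.map d)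

variable {d d₁ d₂ : ℕ → ℤ} {V : Finset ℕ} {a b : ℕ}

theorem monodromy_congr (h : ∀ i ∈ V, d₁ i = d₂ i) : monodromy d₁ V = monodromy d₂ V :=
  congrArg M <| List.map_congr_left fun i hi => h i ((Finset.mem_sort _).1 hi)

theorem sort_eq_append_cons_append (ha : a ∈ V) :
    V.sort = (V.filter (· < a)).sort ++ a :: (V.filter (a < ·)).sort := by
  refine (Finset.sortedLT_sort V).eq_of_mem_iff (List.Pairwise.sortedLT ?_) fun x => ?_
  · simp only [List.pairwise_append, List.pairwise_cons, List.mem_cons, Finset.mem_sort,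
      Finset.mem_filter]
    refine ⟨(Finset.sortedLT_sort _).pairwise,
      ⟨fun _ hx => hx.2, (Finset.sortedLT_sort _).pairwise⟩, ?_⟩
    rintro x ⟨-, hx⟩ y (rfl | ⟨-, hy⟩)
    exacts [hx, hx.trans hy]
  · simp only [List.mem_append, List.mem_cons, Finset.mem_sort, Finset.mem_filter]
    grind

theorem monodromy_split (ha : a ∈ V) : monodromy d V =
    monodromy d (V.filter (a < ·)) * step (d a) * monodromy d (V.filter (· < a)) := by
  rw [monodromy, sort_eq_append_cons_append ha, List.map_append, List.map_cons, M_append, M_cons,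
    monodromy, monodromy]

theorem monodromy_of_forall_eq {x : ℤ} (h : ∀ i ∈ V, d i = x) :
    monodromy d V = step x ^ V.card := by
  rw [monodromy_congr h, monodromy, List.map_const', Finset.length_sort, M_replicate]

theorem monodromy_eq_one (h : V = ∅) : monodromy d V = 1 := by
  rw [monodromy_of_forall_eq (x := 0) (by simp [h]), h, Finset.card_empty, pow_zero]

theorem monodromy_split_split (hab : a < b) (ha : a ∈ V) (hb : b ∈ V) : monodromy d V =
    monodromy d (V.filter (b < ·)) * step (d b) * monodromy d (V.filter (· ∈ Finset.Ioo a b)) *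
      step (d a) * monodromy d (V.filter (· < a)) := by
  rw [monodromy_split ha, monodromy_split (Finset.mem_filter.2 ⟨hb, hab⟩), Finset.filter_filter,
    Finset.filter_filter]
  simp only [Finset.mem_Ioo]
  congr! 6
  grind

theorem monodromy_filter_Icc (hab : a < b) (ha : a ∈ V) (hb : b ∈ V) :
    monodromy d (V.filter (· ∈ Finset.Icc a b)) =
      step (d b) * monodromy d (V.filter (· ∈ Finset.Ioo a b)) * step (d a) := by
  rw [monodromy_split_split hab (by simp [ha, hab.le]) (by simp [hb, hab.le]),
    Finset.filter_filter, Finset.filter_filter, Finset.filter_filter,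
    monodromy_eq_one (V := V.filter fun i => i ∈ Finset.Icc a b ∧ b < i) (by simp +contextual),
    monodromy_eq_one (V := V.filter fun i => i ∈ Finset.Icc a b ∧ i < a) (by simp +contextual),
    one_mul, mul_one]
  congr! 4
  simp only [Finset.mem_Icc, Finset.mem_Ioo]
  omega

theorem monodromy_filter_not_Ioo (hab : a < b) (ha : a ∈ V) (hb : b ∈ V) :
    monodromy d (V.filter (· ∉ Finset.Ioo a b)) =
      monodromy d (V.filter (b < ·)) * step (d b) * step (d a) *
        monodromy d (V.filter (· < a)) := by
  rw [monodromy_split_split hab (by simp [ha]) (by simp [hb]), Finset.filter_filter,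
    Finset.filter_filter, Finset.filter_filter,
    monodromy_eq_one (V := V.filter fun i => i ∉ Finset.Ioo a b ∧ i ∈ Finset.Ioo a b) (by simp),
    mul_one]
  congr! 5 <;> simp only [Finset.mem_Ioo] <;> omega

/-- The matrices of the two pieces of a cut polygon are multiplied by writing `x + y` as
`step (x + y) = -(step x * step 0 * step y)` at both ends of the cut. -/
theorem monodromy_add_of_cut (hab : a < b) (ha : a ∈ V) (hb : b ∈ V) {e₁ e₂ : ℕ}
    (hd₁ : ∀ i ∈ V, i ∉ Finset.Icc a b → d₁ i = 0) (hd₂ : ∀ i ∈ V, i ∈ Finset.Ioo a b → d₂ i = 0)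
    (h₁ : monodromy d₁ (V.filter (· ∈ Finset.Icc a b)) = (-1) ^ e₁)
    (h₂ : monodromy d₂ (V.filter (· ∉ Finset.Ioo a b)) = (-1) ^ e₂) :
    monodromy (d₁ + d₂) V = (-1) ^ (e₁ + e₂ + 1) := by
  rw [monodromy_filter_Icc hab ha hb] at h₁
  rw [monodromy_filter_not_Ioo hab ha hb] at h₂
  have hR : monodromy (d₁ + d₂) (V.filter (b < ·)) = monodromy d₂ (V.filter (b < ·)) :=
    monodromy_congr (by simp +contextual [hd₁])
  have hL : monodromy (d₁ + d₂) (V.filter (· < a)) = monodromy d₂ (V.filter (· < a)) :=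
    monodromy_congr (by simp +contextual [hd₁])
  have hW : monodromy (d₁ + d₂) (V.filter (· ∈ Finset.Ioo a b)) =
      monodromy d₁ (V.filter (· ∈ Finset.Ioo a b)) :=
    monodromy_congr (by simp +contextual [hd₂])
  have hcomm : ∀ X : Matrix (Fin 2) (Fin 2) ℤ, X * (-1) ^ e₁ = (-1) ^ e₁ * X := fun X =>
    (((Commute.one_right X).neg_right).pow_right e₁).eq
  rw [monodromy_split_split hab ha hb, hR, hL, hW, Pi.add_apply, Pi.add_apply,
    add_comm (d₁ b), step_add, step_add]
  generalize monodromy d₂ (V.filter (b < ·)) = R, monodromy d₂ (V.filter (· < a)) = L,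
    monodromy d₁ (V.filter (· ∈ Finset.Ioo a b)) = W at *
  calc R * -(step (d₂ b) * step 0 * step (d₁ b)) * W * -(step (d₁ a) * step 0 * step (d₂ a)) * L
      = R * step (d₂ b) * step 0 * (step (d₁ b) * W * step (d₁ a)) * step 0 * step (d₂ a) * L := by
        noncomm_ring
    _ = (-1) ^ e₁ * (R * step (d₂ b) * (step 0 * step 0) * step (d₂ a) * L) := by
        rw [h₁, hcomm]
        noncomm_ring
    _ = (-1) ^ e₁ * -(R * step (d₂ b) * step (d₂ a) * L) := by
        rw [step_zero_mul_step_zero]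
        noncomm_ring
    _ = (-1) ^ (e₁ + e₂ + 1) := by
        rw [h₂, pow_succ, pow_add, mul_neg, mul_neg_one]

theorem IsFace.monodromy_vertexDegree {E : ℕ → ℕ → Prop} (hV : IsFace E V) (hdvd : 3 ∣ V.card) :
    monodromy (fun i => (vertexDegree E V i : ℤ)) V = (-1) ^ (evenFaces E V + 1) := by
  obtain ⟨j, hj⟩ := hdvd
  have hdeg : ∀ i ∈ V, (vertexDegree E V i : ℤ) = 1 := fun i hi => by
    simp [vertexDegree, faceCount, hV.faces_eq_singleton, Finset.filter_singleton, hi]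
  have heven : evenFaces E V = if Even j then 1 else 0 := by
    rw [evenFaces, faceCount, hV.faces_eq_singleton, Finset.filter_singleton, hj,
      apply_ite Finset.card, Finset.card_singleton, Finset.card_empty]
    simp only [Nat.even_mul, Nat.not_even_bit1 1, false_or]
  rw [monodromy_of_forall_eq hdeg, hj, pow_mul, step_one_pow_three, heven]
  split_ifs with h
  · rw [h.neg_one_pow, one_add_one_eq_two, even_two.neg_one_pow]
  · rw [(Nat.not_even_iff_odd.1 h).neg_one_pow, zero_add, pow_one]

theorem IsPlanar.monodromy_vertexDegree {E : ℕ → ℕ → Prop} (hV : IsPlanar E V)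
    (hcard : 3 ≤ V.card) (hdvd : ∀ P ∈ faces E V, 3 ∣ P.card) :
    monodromy (fun i => (vertexDegree E V i : ℤ)) V = (-1) ^ (evenFaces E V + 1) := by
  revert hdvd
  refine hV.cut_induction (motive := fun V => (∀ P ∈ faces E V, 3 ∣ P.card) →
    monodromy (fun i => (vertexDegree E V i : ℤ)) V = (-1) ^ (evenFaces E V + 1)) ?_ ?_ hcard
  · intro V hface hdvd
    exact hface.monodromy_vertexDegree (hdvd V (by simp [hface.faces_eq_singleton]))
  · intro V a b hV hE hab ha hb inner outer hdvd
    have hcut := isCut_filter hab ha hb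
    have hfaces := hcut.faces_eq hV hE
    have hdeg : (fun i => (vertexDegree E V i : ℤ)) =
        (fun i => (vertexDegree E (V.filter (· ∈ Finset.Icc a b)) i : ℤ)) +
          fun i => (vertexDegree E (V.filter (· ∉ Finset.Ioo a b)) i : ℤ) := by
      ext i
      rw [Pi.add_apply, vertexDegree, hcut.faceCount_eq hV hE, Nat.cast_add, vertexDegree,
        vertexDegree]
    rw [hdeg, monodromy_add_of_cut hab ha hb ?_ ?_ (inner ?_) (outer ?_)]
    · rw [evenFaces, evenFaces, evenFaces, hcut.faceCount_eq hV hE]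
      simp only [pow_succ, pow_add, mul_neg, neg_mul, mul_one, neg_neg]
    · intro i _ hi
      rw [vertexDegree_eq_zero fun h => hi (Finset.mem_filter.1 h).2, Nat.cast_zero]
    · intro i _ hi
      rw [vertexDegree_eq_zero fun h => absurd hi (Finset.mem_filter.1 h).2, Nat.cast_zero]
    · exact fun P hP => hdvd P (hfaces ▸ Finset.mem_union_left _ hP)
    · exact fun P hP => hdvd P (hfaces ▸ Finset.mem_union_right _ hP)

end Monodromy

section Polygon

variable {n : ℕ} {D : Finset (Sym2 ℕ)} {a b c d : ℕ}

/-- `a` and `b` are joined by a side of the `n`-gon or by a diagonal in `D`. -/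
def Edge (n : ℕ) (D : Finset (Sym2 ℕ)) (a b : ℕ) : Prop := IsSide n a b ∨ s(a, b) ∈ D

theorem subPolygons_eq_faces : subPolygons n D = faces (Edge n D) (Finset.Icc 1 n) := by
  ext P
  rw [subPolygons, Finset.mem_filter, Finset.mem_powerset, mem_faces]
  rfl

theorem index_eq_evenFaces : index n D = evenFaces (Edge n D) (Finset.Icc 1 n) := by
  rw [index, subPolygons_eq_faces]
  rfl

theorem quiddity_eq_map_vertexDegree :
    quiddity n D = (List.range' 1 n).map (vertexDegree (Edge n D) (Finset.Icc 1 n)) := by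
  rw [quiddity, subPolygons_eq_faces]
  rfl

theorem is3dDissection_iff : Is3dDissection n D ↔
    IsDissection n D ∧ faceCount (Edge n D) (Finset.Icc 1 n) (¬ 3 ∣ ·.card) = 0 := by
  rw [Is3dDissection, subPolygons_eq_faces, faceCount, Finset.card_eq_zero,
    Finset.filter_eq_empty_iff]
  simp only [not_not]

theorem IsSide.symm (h : IsSide n a b) : IsSide n b a := Or.symm h

theorem isSide_iff_consecutive (ha : a ∈ Finset.Icc 1 n) (hb : b ∈ Finset.Icc 1 n) (hab : a ≠ b) :
    IsSide n a b ↔ Consecutive (Finset.Icc 1 n) a b := by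
  simp only [Finset.mem_Icc] at ha hb
  simp only [IsSide, next, Consecutive, Finset.mem_Icc]
  refine ⟨fun h => ?_, ?_⟩
  · by_cases hspan : min a b = 1 ∧ max a b = n
    · exact Or.inr fun c hc => by omega
    · exact Or.inl fun c hc => by split_ifs at h <;> omega
  · rintro (h | h)
    · have := h (min a b + 1) (by omega)
      split_ifs <;> omega
    · have := h 1 (by omega)
      have := h n (by omega)
      split_ifs <;> omega

theorem IsSide.not_crosses (hside : IsSide n a b) (ha : a ∈ Finset.Icc 1 n)
    (hb : b ∈ Finset.Icc 1 n) (hc : c ∈ Finset.Icc 1 n) (hd : d ∈ Finset.Icc 1 n) :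
    ¬ Crosses a b c d := fun h =>
  consecutive_iff.1 ((isSide_iff_consecutive ha hb h.ne).1 hside) c hc d hd h

theorem IsDissection.not_crosses (hD : IsDissection n D) (hab : s(a, b) ∈ D) (hcd : s(c, d) ∈ D) :
    ¬ Crosses a b c d := by
  wlog hlt : a < b generalizing a b
  · exact fun h => this (Sym2.eq_swap ▸ hab) (lt_of_le_of_ne (not_lt.1 hlt)
      (hD.diagonal a b hab).2.2.1.symm) h.swap_left
  wlog hlt' : c < d generalizing c d
  · exact fun h => this (Sym2.eq_swap ▸ hcd) (lt_of_le_of_ne (not_lt.1 hlt')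
      (hD.diagonal c d hcd).2.2.1.symm) h.swap_right
  have h₁ := hD.noncrossing a c b d
  have h₂ := hD.noncrossing c a d b
  rw [crosses_iff_of_lt hlt]
  simp only [Finset.mem_Ioo, Finset.mem_Icc]
  grind

theorem IsDissection.isPlanar (hD : IsDissection n D) :
    IsPlanar (Edge n D) (Finset.Icc 1 n) where
  symm a b := Or.imp IsSide.symm (Sym2.eq_swap ▸ ·)
  not_crosses := by
    rintro a ha b hb c hc d hd (hab | hab) (hcd | hcd)
    · exact hab.not_crosses ha hb hc hd
    · exact hab.not_crosses ha hb hc hd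
    · exact fun h => hcd.not_crosses hc hd ha hb h.symm
    · exact hD.not_crosses hab hcd
  side a ha b hb hab hcons := Or.inl ((isSide_iff_consecutive ha hb hab).2 hcons)

theorem sort_Icc_one (n : ℕ) : (Finset.Icc 1 n).sort = List.range' 1 n :=
  (Finset.sortedLT_sort _).eq_of_mem_iff (List.sortedLT_range' _ _ one_ne_zero) fun x => by
    rw [Finset.mem_sort, Finset.mem_Icc, List.mem_range'_1]
    omega

theorem IsEven3d.isPositiveSolution_quiddity (hD : IsEven3d n D) :
    IsPositiveSolution n (quiddity n D) := by
  obtain ⟨⟨hdiss, hdvd⟩, heven⟩ := hD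
  have hcard : 3 ≤ (Finset.Icc 1 n).card := by
    rw [Nat.card_Icc]
    exact hdiss.three_le
  rw [quiddity_eq_map_vertexDegree]
  refine ⟨by simp, ?_, ?_⟩
  · simp only [List.forall_mem_map, List.mem_range'_1]
    exact fun i hi => hdiss.isPlanar.vertexDegree_pos hcard (Finset.mem_Icc.2 (by omega))
  · rw [subPolygons_eq_faces] at hdvd
    rw [index_eq_evenFaces] at heven
    have hM := (hdiss.isPlanar.monodromy_vertexDegree hcard hdvd).trans heven.add_one.neg_one_pow
    rw [monodromy, sort_Icc_one] at hM
    -- `IsPositiveSolution` elaborates with the whole list coerced to `List ℤ`, by a monadic bind.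
    simpa only [List.bind_eq_flatMap, List.pure_def, List.flatMap_map, List.map_id',
      ← List.map_eq_flatMap] using hM

end Polygon

section CyclicEmbeddings

/-- `f` maps the vertices of the polygon `V` injectively into a circle and preserves their cyclic
order. -/
structure IsCyclicEmbedding (f : ℕ → ℕ) (V : Finset ℕ) : Prop where
  injOn : Set.InjOn f V
  sbtw : ∀ a ∈ V, ∀ b ∈ V, ∀ c ∈ V, sbtw a b c → sbtw (f a) (f b) (f c)

variable {f : ℕ → ℕ} {E E' : ℕ → ℕ → Prop} {V P : Finset ℕ} {a b c d : ℕ}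

theorem IsCyclicEmbedding.of_strictMonoOn (hf : StrictMonoOn f V) : IsCyclicEmbedding f V where
  injOn := hf.injOn
  sbtw a ha b hb c hc := by
    simp only [sbtw_iff_lt, hf.lt_iff_lt ha hb, hf.lt_iff_lt hb hc, hf.lt_iff_lt hc ha, imp_self]

namespace IsCyclicEmbedding

theorem sbtw_iff (hf : IsCyclicEmbedding f V) (ha : a ∈ V) (hb : b ∈ V) (hc : c ∈ V) :
    SBtw.sbtw (f a) (f b) (f c) ↔ SBtw.sbtw a b c := by
  refine ⟨fun h => ?_, hf.sbtw a ha b hb c hc⟩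
  have hac : a ≠ c := by rintro rfl; exact sbtw_irrefl_left_right h
  have hb' : b ≠ a ∧ b ≠ c := (sbtw_ne h).imp (ne_of_apply_ne f) (ne_of_apply_ne f)
  exact (sbtw_or_sbtw hac hb'.1 hb'.2).resolve_right fun h' =>
    h.not_sbtw (hf.sbtw c hc b hb a ha h')

theorem crosses_iff (hf : IsCyclicEmbedding f V) (ha : a ∈ V) (hb : b ∈ V) (hc : c ∈ V)
    (hd : d ∈ V) : Crosses (f a) (f b) (f c) (f d) ↔ Crosses a b c d := by
  simp only [Crosses, hf.sbtw_iff, ha, hb, hc, hd]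

theorem consecutive_image (hf : IsCyclicEmbedding f V) (hP : P ⊆ V) (ha : a ∈ V) (hb : b ∈ V) :
    Consecutive (P.image f) (f a) (f b) ↔ Consecutive P a b := by
  simp only [consecutive_iff, Finset.forall_mem_image]
  exact forall₂_congr fun c hc => forall₂_congr fun d hd =>
    not_congr (hf.crosses_iff ha hb (hP hc) (hP hd))

theorem card_image (hf : IsCyclicEmbedding f V) (hP : P ⊆ V) : (P.image f).card = P.card :=
  Finset.card_image_of_injOn (hf.injOn.mono hP)

theorem mem_image (hf : IsCyclicEmbedding f V) (hP : P ⊆ V) (ha : a ∈ V) :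
    f a ∈ P.image f ↔ a ∈ P := by
  simpa using hf.injOn.mem_image_iff (Finset.coe_subset.2 hP) ha

theorem isFace_image (hf : IsCyclicEmbedding f V)
    (hE : ∀ a ∈ V, ∀ b ∈ V, a ≠ b → (E' (f a) (f b) ↔ E a b)) (hP : P ⊆ V) :
    IsFace E' (P.image f) ↔ IsFace E P := by
  simp only [IsFace, Finset.forall_mem_image, hf.card_image hP]
  refine and_congr_right fun _ => forall₂_congr fun a ha => forall₂_congr fun b hb => ?_
  rw [(hf.injOn).ne_iff (hP ha) (hP hb), hf.consecutive_image hP (hP ha) (hP hb)]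
  exact forall_congr' fun hab => iff_congr (hE a (hP ha) b (hP hb) hab) Iff.rfl

theorem faces_image (hf : IsCyclicEmbedding f V)
    (hE : ∀ a ∈ V, ∀ b ∈ V, a ≠ b → (E' (f a) (f b) ↔ E a b)) :
    faces E' (V.image f) = (faces E V).image (Finset.image f) := by
  ext Q
  simp only [Finset.mem_image, mem_faces, Finset.subset_image_iff]
  constructor
  · rintro ⟨⟨P, hP, rfl⟩, hface⟩
    exact ⟨P, ⟨hP, (hf.isFace_image hE hP).1 hface⟩, rfl⟩
  · rintro ⟨P, ⟨hP, hface⟩, rfl⟩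
    exact ⟨⟨P, hP, rfl⟩, (hf.isFace_image hE hP).2 hface⟩

theorem faceCount_image (hf : IsCyclicEmbedding f V)
    (hE : ∀ a ∈ V, ∀ b ∈ V, a ≠ b → (E' (f a) (f b) ↔ E a b))
    (p : Finset ℕ → Prop) [DecidablePred p] :
    faceCount E' (V.image f) p = faceCount E V fun P => p (P.image f) := by
  rw [faceCount, hf.faces_image hE, Finset.filter_image, Finset.card_image_of_injOn, faceCount]
  exact (Finset.image_injOn_powerset_of_injOn hf.injOn).mono fun P hP =>
    Finset.mem_powerset.2 (mem_faces.1 (Finset.mem_filter.1 hP).1).1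

end IsCyclicEmbedding

end CyclicEmbeddings

section Gluings

variable {n m N k l p r : ℕ} {f g : ℕ → ℕ} {S T : Finset (Sym2 ℕ)} {a b x y : ℕ}

theorem IsSide.ne (hn : 2 ≤ n) (h : IsSide n a b) : a ≠ b := by
  rintro rfl
  unfold IsSide next at h
  split_ifs at h <;> omega

theorem IsPlanar.isFace_of_card_eq_three {E : ℕ → ℕ → Prop} {V : Finset ℕ} (hV : IsPlanar E V)
    (hcard : V.card = 3) : IsFace E V := by
  by_contra hface
  obtain ⟨a, ha, b, hb, hab, -, c, hc, d, hd, hcab, hdab⟩ := hV.exists_chord hcard.ge hface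
  rw [Finset.mem_Icc] at hdab
  rw [Finset.mem_Ioo] at hcab
  have hthree : 2 < (V.erase d).card :=
    Finset.two_lt_card.2 ⟨a, Finset.mem_erase.2 ⟨by omega, ha⟩, b,
      Finset.mem_erase.2 ⟨by omega, hb⟩, c, Finset.mem_erase.2 ⟨by omega, hc⟩, by omega, by omega,
      by omega⟩
  rw [Finset.card_erase_of_mem hd] at hthree
  omega

/-- An `n`-gon and an `m`-gon are drawn by `f` and `g` in the `N`-gon so that the vertices
`k` and `p` coincide and the neighbours `l` of `k` and `r` of `p` are joined by a side. -/
structure IsGluing (n m N : ℕ) (f g : ℕ → ℕ) (k l p r : ℕ) : Prop where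
  left : IsCyclicEmbedding f (Finset.Icc 1 n)
  right : IsCyclicEmbedding g (Finset.Icc 1 m)
  union_eq : (Finset.Icc 1 n).image f ∪ (Finset.Icc 1 m).image g = Finset.Icc 1 N
  left_mem : k ∈ Finset.Icc 1 n ∧ l ∈ Finset.Icc 1 n
  right_mem : p ∈ Finset.Icc 1 m ∧ r ∈ Finset.Icc 1 m
  eq_iff : ∀ a ∈ Finset.Icc 1 n, ∀ b ∈ Finset.Icc 1 m, f a = g b ↔ a = k ∧ b = p
  not_crosses : ∀ a ∈ Finset.Icc 1 n, ∀ b ∈ Finset.Icc 1 n, ∀ c ∈ Finset.Icc 1 m,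
    ∀ d ∈ Finset.Icc 1 m, ¬ Crosses (f a) (f b) (g c) (g d)
  left_side : IsSide n k l
  right_side : IsSide m p r
  side : IsSide N (f l) (g r)

/-- The diagonals of two glued dissections: the old ones and the sides `kl` and `pr` of the two
polygons. -/
def glue (f g : ℕ → ℕ) (k l p r : ℕ) (S T : Finset (Sym2 ℕ)) : Finset (Sym2 ℕ) :=
  (insert s(k, l) S).image (Sym2.map f) ∪ (insert s(p, r) T).image (Sym2.map g)

theorem glue_comm : glue f g k l p r S T = glue g f p r k l T S := Finset.union_comm _ _

theorem IsDissection.mem_of_mem_insert (hS : IsDissection n S)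
    (hk : k ∈ Finset.Icc 1 n) (hl : l ∈ Finset.Icc 1 n) (hkl : IsSide n k l)
    (hab : s(a, b) ∈ insert s(k, l) S) : a ∈ Finset.Icc 1 n ∧ b ∈ Finset.Icc 1 n ∧ a ≠ b := by
  rcases Finset.mem_insert.1 hab with heq | hab
  · have hne := hkl.ne (Nat.le_of_succ_le hS.three_le)
    rcases Sym2.eq_iff.1 heq with ⟨rfl, rfl⟩ | ⟨rfl, rfl⟩
    exacts [⟨hk, hl, hne⟩, ⟨hl, hk, hne.symm⟩]
  · have ⟨ha, hb, hne, _⟩ := hS.diagonal a b hab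
    exact ⟨ha, hb, hne⟩

theorem exists_of_mem_image_map {D : Finset (Sym2 ℕ)} (hxy : s(x, y) ∈ D.image (Sym2.map f)) :
    ∃ a b, s(a, b) ∈ D ∧ f a = x ∧ f b = y := by
  obtain ⟨e, he, hexy⟩ := Finset.mem_image.1 hxy
  induction e with | _ a b
  rcases Sym2.eq_iff.1 hexy with ⟨ha, hb⟩ | ⟨ha, hb⟩
  exacts [⟨a, b, he, ha, hb⟩, ⟨b, a, Sym2.eq_swap ▸ he, hb, ha⟩]

theorem edge_of_mem_insert (hkl : IsSide n k l) (hab : s(a, b) ∈ insert s(k, l) S) :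
    Edge n S a b := by
  rcases Finset.mem_insert.1 hab with heq | hab
  · rcases Sym2.eq_iff.1 heq with ⟨rfl, rfl⟩ | ⟨rfl, rfl⟩
    exacts [Or.inl hkl, Or.inl hkl.symm]
  · exact Or.inr hab

namespace IsGluing

theorem symm (h : IsGluing n m N f g k l p r) : IsGluing m n N g f p r k l where
  left := h.right
  right := h.left
  union_eq := by rw [Finset.union_comm, h.union_eq]
  left_mem := h.right_mem
  right_mem := h.left_mem
  eq_iff a ha b hb := by rw [eq_comm, h.eq_iff b hb a ha, and_comm]
  not_crosses a ha b hb c hc d hd hcross := h.not_crosses c hc d hd a ha b hb hcross.symm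
  left_side := h.right_side
  right_side := h.left_side
  side := h.side.symm

theorem map_eq (h : IsGluing n m N f g k l p r) : f k = g p :=
  (h.eq_iff k h.left_mem.1 p h.right_mem.1).2 ⟨rfl, rfl⟩

theorem left_map_mem (h : IsGluing n m N f g k l p r) (ha : a ∈ Finset.Icc 1 n) :
    f a ∈ Finset.Icc 1 N :=
  h.union_eq ▸ Finset.mem_union_left _ (Finset.mem_image_of_mem f ha)

theorem left_map_mem_right (h : IsGluing n m N f g k l p r) (ha : a ∈ Finset.Icc 1 n) {P : Finset ℕ}
    (hP : P ⊆ Finset.Icc 1 m) : f a ∈ P.image g ↔ a = k ∧ p ∈ P := by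
  simp only [Finset.mem_image]
  constructor
  · rintro ⟨b, hb, hab⟩
    obtain ⟨rfl, rfl⟩ := (h.eq_iff a ha b (hP hb)).1 hab.symm
    exact ⟨rfl, hb⟩
  · rintro ⟨rfl, hp⟩
    exact ⟨p, hp, h.map_eq.symm⟩

/-- A chord of the first polygon that separates `f l` from a vertex of the second one separates it
from the neighbour `g r` or separates two vertices of the second polygon. -/
theorem not_crosses_left (h : IsGluing n m N f g k l p r) (hm : 2 ≤ m) (ha : a ∈ Finset.Icc 1 n)
    (hb : b ∈ Finset.Icc 1 n) {c : ℕ} (hc : c ∈ Finset.Icc 1 m) :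
    ¬ Crosses (f a) (f b) (f l) (g c) := by
  have hne : ∀ a ∈ Finset.Icc 1 n, g r ≠ f a := fun a ha heq =>
    (h.right_side.ne hm).symm ((h.eq_iff a ha r h.right_mem.2).1 heq.symm).2
  intro hcross
  rcases hcross.or_of_ne (hne a ha) (hne b hb) with hcross | hcross
  · exact h.side.not_crosses (h.left_map_mem h.left_mem.2) (h.symm.left_map_mem h.right_mem.2)
      (h.left_map_mem ha) (h.left_map_mem hb) hcross.symm
  · exact h.not_crosses a ha b hb c hc r h.right_mem.2 hcross

theorem isCut_left (h : IsGluing n m N f g k l p r) (hn : 2 ≤ n) (hm : 2 ≤ m) :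
    IsCut (Finset.Icc 1 N) ((Finset.Icc 1 n).image f)
      (insert (f l) ((Finset.Icc 1 m).image g)) (f k) (f l) where
  ne := h.left.injOn.ne h.left_mem.1 h.left_mem.2 (h.left_side.ne hn)
  union_eq := by
    rw [Finset.union_insert, h.union_eq, Finset.insert_eq_of_mem (h.left_map_mem h.left_mem.2)]
  inter_eq := by
    ext x
    simp only [Finset.mem_inter, Finset.mem_insert, Finset.mem_singleton]
    constructor
    · rintro ⟨hx, rfl | hx'⟩
      · exact Or.inr rfl
      · obtain ⟨a, ha, rfl⟩ := Finset.mem_image.1 hx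
        exact Or.inl (congrArg f ((h.left_map_mem_right ha subset_rfl).1 hx').1)
    · rintro (rfl | rfl)
      · exact ⟨Finset.mem_image_of_mem f h.left_mem.1,
          Or.inr (h.map_eq ▸ Finset.mem_image_of_mem g h.right_mem.1)⟩
      · exact ⟨Finset.mem_image_of_mem f h.left_mem.2, Or.inl rfl⟩
  not_crosses := by
    simp only [Finset.forall_mem_image, Finset.forall_mem_insert]
    intro a ha b hb
    exact ⟨⟨fun hcross => hcross.symm.ne rfl, fun c hc => h.not_crosses_left hm ha hb hc⟩,
      fun c hc => ⟨fun hcross => h.not_crosses_left hm ha hb hc hcross.swap_right,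
        fun d hd => h.not_crosses a ha b hb c hc d hd⟩⟩

theorem isCut_right (h : IsGluing n m N f g k l p r) (hn : 2 ≤ n) (hm : 2 ≤ m) :
    IsCut (insert (f l) ((Finset.Icc 1 m).image g)) ((Finset.Icc 1 m).image g)
      {f k, f l, g r} (f k) (g r) where
  ne := by
    rw [h.map_eq]
    exact h.symm.left.injOn.ne h.right_mem.1 h.right_mem.2 (h.right_side.ne hm)
  union_eq := by
    have hk := h.map_eq ▸ Finset.mem_image_of_mem g h.right_mem.1
    have hr := Finset.mem_image_of_mem g h.right_mem.2
    grind
  inter_eq := by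
    have hk := h.map_eq ▸ Finset.mem_image_of_mem g h.right_mem.1
    have hr := Finset.mem_image_of_mem g h.right_mem.2
    have hl : f l ∉ (Finset.Icc 1 m).image g := fun hl =>
      h.left_side.ne hn ((h.left_map_mem_right h.left_mem.2 subset_rfl).1 hl).1.symm
    grind
  not_crosses := by
    have ⟨hk, hl⟩ := h.left_mem
    have ⟨hp, hr⟩ := h.right_mem
    simp only [Finset.forall_mem_image, Finset.forall_mem_insert, Finset.mem_singleton,
      forall_eq]
    intro a ha b hb
    have hkl : ¬ Crosses (g a) (g b) (f k) (f l) := fun hcross =>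
      h.not_crosses k hk l hl a ha b hb hcross.symm
    have hlr : ¬ Crosses (g a) (g b) (f l) (g r) := fun hcross =>
      h.side.not_crosses (h.left_map_mem hl) (h.symm.left_map_mem hr)
        (h.symm.left_map_mem ha) (h.symm.left_map_mem hb) hcross.symm
    have hkr : ¬ Crosses (g a) (g b) (f k) (g r) := by
      rw [h.map_eq, h.right.crosses_iff ha hb hp hr]
      exact fun hcross => h.right_side.not_crosses hp hr ha hb hcross.symm
    have hself : ∀ x, ¬ Crosses (g a) (g b) x x := fun x hcross => hcross.symm.ne rfl
    exact ⟨⟨hself _, hkl, hkr⟩, ⟨mt Crosses.swap_right hkl, hself _, hlr⟩,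
      mt Crosses.swap_right hkr, mt Crosses.swap_right hlr, hself _⟩

theorem exists_of_mem_glue (h : IsGluing n m N f g k l p r) (hS : IsDissection n S)
    (hT : IsDissection m T) (hxy : s(x, y) ∈ glue f g k l p r S T) :
    (∃ a ∈ Finset.Icc 1 n, ∃ b ∈ Finset.Icc 1 n, a ≠ b ∧ s(a, b) ∈ insert s(k, l) S ∧
      f a = x ∧ f b = y) ∨
    ∃ a ∈ Finset.Icc 1 m, ∃ b ∈ Finset.Icc 1 m, a ≠ b ∧ s(a, b) ∈ insert s(p, r) T ∧
      g a = x ∧ g b = y := by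
  refine (Finset.mem_union.1 hxy).imp (fun hxy => ?_) fun hxy => ?_
  · obtain ⟨a, b, hab, hfa, hfb⟩ := exists_of_mem_image_map hxy
    have ⟨ha, hb, hne⟩ := hS.mem_of_mem_insert h.left_mem.1 h.left_mem.2 h.left_side hab
    exact ⟨a, ha, b, hb, hne, hab, hfa, hfb⟩
  · obtain ⟨a, b, hab, hga, hgb⟩ := exists_of_mem_image_map hxy
    have ⟨ha, hb, hne⟩ := hT.mem_of_mem_insert h.right_mem.1 h.right_mem.2 h.right_side hab
    exact ⟨a, ha, b, hb, hne, hab, hga, hgb⟩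

theorem isSide_of_isSide_map (h : IsGluing n m N f g k l p r) (ha : a ∈ Finset.Icc 1 n)
    (hb : b ∈ Finset.Icc 1 n) (hab : a ≠ b) (hside : IsSide N (f a) (f b)) : IsSide n a b := by
  rw [isSide_iff_consecutive ha hb hab, ← h.left.consecutive_image subset_rfl ha hb,
    consecutive_iff]
  simp only [Finset.forall_mem_image]
  exact fun c hc d hd => hside.not_crosses (h.left_map_mem ha) (h.left_map_mem hb)
    (h.left_map_mem hc) (h.left_map_mem hd)

theorem edge_left (h : IsGluing n m N f g k l p r) (hS : IsDissection n S)
    (hT : IsDissection m T) (ha : a ∈ Finset.Icc 1 n) (hb : b ∈ Finset.Icc 1 n) (hab : a ≠ b) :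
    Edge N (glue f g k l p r S T) (f a) (f b) ↔ Edge n S a b := by
  have hcut := h.isCut_left (by have := hS.three_le; omega) (by have := hT.three_le; omega)
  constructor
  · rintro (hside | hmem)
    · exact Or.inl (h.isSide_of_isSide_map ha hb hab hside)
    · rcases h.exists_of_mem_glue hS hT hmem with
        ⟨a', ha', b', hb', -, hmem, heqa, heqb⟩ | ⟨a', ha', b', hb', -, -, heqa, heqb⟩
      · rw [h.left.injOn ha' ha heqa, h.left.injOn hb' hb heqb] at hmem
        exact edge_of_mem_insert h.left_side hmem
      · exact absurd (((h.eq_iff a ha a' ha').1 heqa.symm).1.trans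
          ((h.eq_iff b hb b' hb').1 heqb.symm).1.symm) hab
  · rintro (hside | hmem)
    · have hcons := (h.left.consecutive_image subset_rfl ha hb).2
        ((isSide_iff_consecutive ha hb hab).1 hside)
      refine (hcut.consecutive_left (Finset.mem_image_of_mem f ha) (Finset.mem_image_of_mem f hb)
        hcons).imp (isSide_iff_consecutive (h.left_map_mem ha) (h.left_map_mem hb)
          (h.left.injOn.ne ha hb hab)).2 fun heq => ?_
      rw [heq]
      exact Finset.mem_union_left _
        (Finset.mem_image_of_mem (Sym2.map f) (Finset.mem_insert_self _ _))
    · exact Or.inr (Finset.mem_union_left _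
        (Finset.mem_image_of_mem (Sym2.map f) (Finset.mem_insert_of_mem hmem)))

theorem not_isSide_map (h : IsGluing n m N f g k l p r) (hS : IsDissection n S) (hm : 2 ≤ m)
    (hab : s(a, b) ∈ insert s(k, l) S) : ¬ IsSide N (f a) (f b) := by
  have ⟨hk, hl⟩ := h.left_mem
  have hn := hS.three_le
  rcases Finset.mem_insert.1 hab with heq | hmem
  · have hcut := h.isCut_left (by omega) hm
    obtain ⟨c, hc, hckl⟩ := Finset.exists_mem_notMem_of_card_lt_card
      (Finset.card_le_two.trans_lt (by rw [Nat.card_Icc]; omega) :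
        ({k, l} : Finset ℕ).card < (Finset.Icc 1 n).card)
    simp only [Finset.mem_insert, Finset.mem_singleton, not_or] at hckl
    have hfc : f c ∉ insert (f l) ((Finset.Icc 1 m).image g) := by
      rw [Finset.mem_insert, h.left_map_mem_right hc subset_rfl]
      exact not_or.2 ⟨h.left.injOn.ne hc hl hckl.2, fun hck => hckl.1 hck.1⟩
    have hgr : g r ∉ (Finset.Icc 1 n).image f := by
      rw [h.symm.left_map_mem_right h.right_mem.2 subset_rfl]
      exact fun hrp => h.right_side.ne hm hrp.1.symm
    have hcross := hcut.crosses (Finset.mem_image_of_mem f hc) hfc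
      (Finset.mem_insert_of_mem (Finset.mem_image_of_mem g h.right_mem.2)) hgr
    have hkl : ¬ IsSide N (f k) (f l) := fun hside =>
      hside.not_crosses (h.left_map_mem hk) (h.left_map_mem hl) (h.left_map_mem hc)
        (h.symm.left_map_mem h.right_mem.2) hcross
    rcases Sym2.eq_iff.1 heq with ⟨rfl, rfl⟩ | ⟨rfl, rfl⟩
    exacts [hkl, fun hside => hkl hside.symm]
  · have ⟨ha, hb, hne, hside⟩ := hS.diagonal a b hmem
    exact mt (h.isSide_of_isSide_map ha hb hne) hside

theorem not_crosses_of_mem_glue (h : IsGluing n m N f g k l p r) (hS : IsDissection n S)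
    (hT : IsDissection m T) {z w : ℕ} (hxy : s(x, y) ∈ glue f g k l p r S T)
    (hzw : s(z, w) ∈ glue f g k l p r S T) : ¬ Crosses x y z w := by
  rcases h.exists_of_mem_glue hS hT hxy with
      ⟨a, ha, b, hb, -, hab, rfl, rfl⟩ | ⟨a, ha, b, hb, -, hab, rfl, rfl⟩ <;>
    rcases h.exists_of_mem_glue hS hT hzw with
      ⟨c, hc, d, hd, -, hcd, rfl, rfl⟩ | ⟨c, hc, d, hd, -, hcd, rfl, rfl⟩
  · rw [h.left.crosses_iff ha hb hc hd]
    exact hS.isPlanar.not_crosses a ha b hb c hc d hd (edge_of_mem_insert h.left_side hab)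
      (edge_of_mem_insert h.left_side hcd)
  · exact h.not_crosses a ha b hb c hc d hd
  · exact h.symm.not_crosses a ha b hb c hc d hd
  · rw [h.right.crosses_iff ha hb hc hd]
    exact hT.isPlanar.not_crosses a ha b hb c hc d hd (edge_of_mem_insert h.right_side hab)
      (edge_of_mem_insert h.right_side hcd)

theorem isDissection_glue (h : IsGluing n m N f g k l p r) (hS : IsDissection n S)
    (hT : IsDissection m T) : IsDissection N (glue f g k l p r S T) where
  three_le := by
    have hcard := Finset.card_le_card_of_injOn f (fun _ => h.left_map_mem) h.left.injOn
    rw [Nat.card_Icc, Nat.card_Icc] at hcard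
    have := hS.three_le
    omega
  diagonal x y hxy := by
    have hn : 2 ≤ n := Nat.le_of_succ_le hS.three_le
    have hm : 2 ≤ m := Nat.le_of_succ_le hT.three_le
    rcases h.exists_of_mem_glue hS hT hxy with
      ⟨a, ha, b, hb, hne, hab, rfl, rfl⟩ | ⟨a, ha, b, hb, hne, hab, rfl, rfl⟩
    · exact ⟨h.left_map_mem ha, h.left_map_mem hb, h.left.injOn.ne ha hb hne,
        h.not_isSide_map hS hm hab⟩
    · exact ⟨h.symm.left_map_mem ha, h.symm.left_map_mem hb, h.right.injOn.ne ha hb hne,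
        h.symm.not_isSide_map hT hn hab⟩
  noncrossing a b c d hab hbc hcd hD := h.not_crosses_of_mem_glue hS hT hD.1 hD.2 <|
    (crosses_iff_of_lt (hab.trans hbc)).2 <| Or.inl
      ⟨Finset.mem_Ioo.2 ⟨hab, hbc⟩, fun hd => hcd.not_ge (Finset.mem_Icc.1 hd).2⟩

theorem card_triangle (h : IsGluing n m N f g k l p r) (hn : 2 ≤ n) (hm : 2 ≤ m) :
    ({f k, f l, g r} : Finset ℕ).card = 3 := by
  refine Finset.card_eq_three.2 ⟨f k, f l, g r, (h.isCut_left hn hm).ne, (h.isCut_right hn hm).ne,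
    fun heq => ?_, rfl⟩
  exact h.left_side.ne hn ((h.eq_iff l h.left_mem.2 r h.right_mem.2).1 heq).1.symm

theorem edge_right (h : IsGluing n m N f g k l p r) (hS : IsDissection n S)
    (hT : IsDissection m T) (ha : a ∈ Finset.Icc 1 m) (hb : b ∈ Finset.Icc 1 m) (hab : a ≠ b) :
    Edge N (glue f g k l p r S T) (g a) (g b) ↔ Edge m T a b := by
  rw [glue_comm]
  exact h.symm.edge_left hT hS ha hb hab

theorem faceCount_glue (h : IsGluing n m N f g k l p r) (hS : IsDissection n S)
    (hT : IsDissection m T) (q : Finset ℕ → Prop) [DecidablePred q] :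
    faceCount (Edge N (glue f g k l p r S T)) (Finset.Icc 1 N) q =
      faceCount (Edge n S) (Finset.Icc 1 n) (fun P => q (P.image f)) +
      faceCount (Edge m T) (Finset.Icc 1 m) (fun P => q (P.image g)) +
      if q {f k, f l, g r} then 1 else 0 := by
  have hn : 2 ≤ n := Nat.le_of_succ_le hS.three_le
  have hm : 2 ≤ m := Nat.le_of_succ_le hT.three_le
  have hV := (h.isDissection_glue hS hT).isPlanar
  have hkl : Edge N (glue f g k l p r S T) (f k) (f l) :=
    (h.edge_left hS hT h.left_mem.1 h.left_mem.2 (h.left_side.ne hn)).2 (Or.inl h.left_side)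
  have hpr : Edge N (glue f g k l p r S T) (f k) (g r) := h.map_eq ▸
    (h.edge_right hS hT h.right_mem.1 h.right_mem.2 (h.right_side.ne hm)).2 (Or.inl h.right_side)
  have hcut₁ := h.isCut_left hn hm
  have hcut₂ := h.isCut_right hn hm
  have hB := hcut₁.symm.isPlanar_left hV hkl
  have htriangle := (hcut₂.symm.isPlanar_left hB hpr).isFace_of_card_eq_three
    (h.card_triangle hn hm)
  rw [hcut₁.faceCount_eq hV hkl, hcut₂.faceCount_eq hB hpr,
    h.left.faceCount_image fun a ha b hb => h.edge_left hS hT ha hb,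
    h.right.faceCount_image fun a ha b hb => h.edge_right hS hT ha hb, ← add_assoc]
  congr 1
  rw [faceCount, htriangle.faces_eq_singleton, Finset.filter_singleton, apply_ite Finset.card,
    Finset.card_singleton, Finset.card_empty]

theorem faceCount_glue_card (h : IsGluing n m N f g k l p r) (hS : IsDissection n S)
    (hT : IsDissection m T) (q : ℕ → Prop) [DecidablePred q] :
    faceCount (Edge N (glue f g k l p r S T)) (Finset.Icc 1 N) (q ·.card) =
      faceCount (Edge n S) (Finset.Icc 1 n) (q ·.card) +
      faceCount (Edge m T) (Finset.Icc 1 m) (q ·.card) + if q 3 then 1 else 0 := by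
  simp only [h.faceCount_glue hS hT, h.card_triangle (Nat.le_of_succ_le hS.three_le)
    (Nat.le_of_succ_le hT.three_le)]
  congr 2 <;> refine faceCount_congr fun P hP => ?_
  · rw [h.left.card_image hP]
  · rw [h.right.card_image hP]

theorem is3dDissection_glue (h : IsGluing n m N f g k l p r) (hS : Is3dDissection n S)
    (hT : Is3dDissection m T) : Is3dDissection N (glue f g k l p r S T) := by
  rw [is3dDissection_iff] at hS hT ⊢
  exact ⟨h.isDissection_glue hS.1 hT.1, by
    rw [h.faceCount_glue_card hS.1 hT.1 (¬ 3 ∣ ·), hS.2, hT.2, if_neg (by decide)]⟩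

theorem index_glue (h : IsGluing n m N f g k l p r) (hS : IsDissection n S)
    (hT : IsDissection m T) : index N (glue f g k l p r S T) = index n S + index m T := by
  simp only [index_eq_evenFaces, evenFaces]
  rw [h.faceCount_glue_card hS hT Even, if_neg (by decide), add_zero]

theorem isEven3d_glue (h : IsGluing n m N f g k l p r) (hS : Is3dDissection n S)
    (hT : Is3dDissection m T) (heven : Even (index n S + index m T)) :
    IsEven3d N (glue f g k l p r S T) :=
  ⟨h.is3dDissection_glue hS hT, (h.index_glue hS.1 hT.1).symm ▸ heven⟩

theorem vertexDegree_glue_left (h : IsGluing n m N f g k l p r) (hS : IsDissection n S)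
    (hT : IsDissection m T) (ha : a ∈ Finset.Icc 1 n) :
    vertexDegree (Edge N (glue f g k l p r S T)) (Finset.Icc 1 N) (f a) =
      vertexDegree (Edge n S) (Finset.Icc 1 n) a +
      (if a = k then vertexDegree (Edge m T) (Finset.Icc 1 m) p + 1 else 0) +
      if a = l then 1 else 0 := by
  have hkl := h.left_side.ne (Nat.le_of_succ_le hS.three_le)
  have hleft : faceCount (Edge n S) (Finset.Icc 1 n) (fun P => f a ∈ P.image f) =
      vertexDegree (Edge n S) (Finset.Icc 1 n) a :=
    faceCount_congr fun P hP => h.left.mem_image hP ha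
  have hright : faceCount (Edge m T) (Finset.Icc 1 m) (fun P => f a ∈ P.image g) =
      if a = k then vertexDegree (Edge m T) (Finset.Icc 1 m) p else 0 := by
    rw [faceCount_congr fun P hP => h.left_map_mem_right ha hP]
    split_ifs with hak
    · simp only [hak, true_and, vertexDegree]
    · simp [hak, faceCount]
  have htriangle : f a ∈ ({f k, f l, g r} : Finset ℕ) ↔ a = k ∨ a = l := by
    have hr : f a = g r → a = k := fun heq => ((h.eq_iff a ha r h.right_mem.2).1 heq).1
    rw [Finset.mem_insert, Finset.mem_insert, Finset.mem_singleton,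
      h.left.injOn.eq_iff ha h.left_mem.1, h.left.injOn.eq_iff ha h.left_mem.2]
    tauto
  rw [vertexDegree, h.faceCount_glue hS hT, hleft, hright]
  simp only [htriangle]
  split_ifs <;> grind

theorem vertexDegree_glue_right (h : IsGluing n m N f g k l p r) (hS : IsDissection n S)
    (hT : IsDissection m T) (hb : b ∈ Finset.Icc 1 m) (hbp : b ≠ p) :
    vertexDegree (Edge N (glue f g k l p r S T)) (Finset.Icc 1 N) (g b) =
      vertexDegree (Edge m T) (Finset.Icc 1 m) b + if b = r then 1 else 0 := by
  rw [glue_comm, h.symm.vertexDegree_glue_left hT hS hb, if_neg hbp, add_zero]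

end IsGluing

end Gluings

section Products

variable {n m j k l r : ℕ} {g : ℕ → ℕ} {S T : Finset (Sym2 ℕ)}

theorem strictMono_shift : StrictMono (shift m j) := by
  intro a b hab
  unfold shift
  split_ifs <;> omega

/-- `g` labels the vertices of an `m`-gon whose vertex `1` is put on vertex `k` of an `n`-gon and
whose other vertices are inserted between the vertices `j` and `j + 1`, `k` being one of these
two. -/
structure IsInsertion (n m j k : ℕ) (g : ℕ → ℕ) : Prop where
  mem : j ∈ Finset.Icc 1 n
  eq_or_eq : k = j ∨ k = next n j
  map_one : g 1 = shift m j k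
  map_of_two_le : ∀ i, 2 ≤ i → g i = j + i - 1

namespace IsInsertion

theorem mem_right (h : IsInsertion n m j k g) : k ∈ Finset.Icc 1 n := by
  have ⟨hj, hk, _, _⟩ := h
  unfold next at hk
  grind

theorem map_cases (h : IsInsertion n m j k g) {i : ℕ} (hi : 1 ≤ i) :
    i = 1 ∧ g i = shift m j k ∨ 1 < i ∧ g i = j + i - 1 := by
  rcases hi.eq_or_lt with rfl | hlt
  exacts [Or.inl ⟨rfl, h.map_one⟩, Or.inr ⟨hlt, h.map_of_two_le i hlt⟩]

theorem shift_cases (h : IsInsertion n m j k g) :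
    shift m j k = j ∨ j < n ∧ shift m j k = j + 1 + (m - 1) ∨ j = n ∧ shift m j k = 1 := by
  have ⟨hj, hk, _, _⟩ := h
  unfold shift next at *
  grind

theorem isCyclicEmbedding (h : IsInsertion n m j k g) : IsCyclicEmbedding g (Finset.Icc 1 m) := by
  have hj := Finset.mem_Icc.1 h.mem
  have hk := h.shift_cases
  constructor
  · intro a ha b hb hab
    simp only [Finset.coe_Icc, Set.mem_Icc] at ha hb
    have := h.map_cases ha.1
    have := h.map_cases hb.1
    omega
  · intro a ha b hb c hc
    simp only [Finset.mem_Icc] at ha hb hc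
    simp only [sbtw_iff_lt]
    have := h.map_cases ha.1
    have := h.map_cases hb.1
    have := h.map_cases hc.1
    omega

theorem union_eq (h : IsInsertion n m j k g) (hm : 1 ≤ m) :
    (Finset.Icc 1 n).image (shift m j) ∪ (Finset.Icc 1 m).image g = Finset.Icc 1 (n + m - 1) := by
  have hj := Finset.mem_Icc.1 h.mem
  have hk := h.shift_cases
  ext x
  simp only [Finset.mem_union, Finset.mem_image, Finset.mem_Icc]
  constructor
  · rintro (⟨a, ha, rfl⟩ | ⟨b, hb, rfl⟩)
    · unfold shift
      split_ifs <;> omega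
    · have := h.map_cases hb.1
      omega
  · intro hx
    rcases lt_or_ge j x with hjx | hxj
    · rcases lt_or_ge x (j + m) with hxm | hmx
      · exact Or.inr ⟨x - j + 1, by omega, by rw [h.map_of_two_le _ (by omega)]; omega⟩
      · exact Or.inl ⟨x - (m - 1), by omega, by rw [shift, if_neg (by omega)]; omega⟩
    · exact Or.inl ⟨x, by omega, if_pos hxj⟩

theorem shift_eq_iff (h : IsInsertion n m j k g) {a b : ℕ} (hb : b ∈ Finset.Icc 1 m) :
    shift m j a = g b ↔ a = k ∧ b = 1 := by
  rw [Finset.mem_Icc] at hb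
  rcases h.map_cases hb.1 with ⟨rfl, hg⟩ | ⟨hlt, hg⟩
  · rw [hg, strictMono_shift.injective.eq_iff, and_iff_left rfl]
  · rw [hg, shift]
    split_ifs <;> omega

theorem not_crosses (h : IsInsertion n m j k g) {a b c d : ℕ} (ha : a ∈ Finset.Icc 1 n)
    (hb : b ∈ Finset.Icc 1 n) (hc : c ∈ Finset.Icc 1 m) (hd : d ∈ Finset.Icc 1 m) :
    ¬ Crosses (shift m j a) (shift m j b) (g c) (g d) := by
  have hj := Finset.mem_Icc.1 h.mem
  simp only [Finset.mem_Icc] at ha hb hc hd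
  have hga := h.map_cases hc.1
  have hgb := h.map_cases hd.1
  intro hcross
  rcases h.shift_cases with hk | ⟨_, hk⟩ | ⟨rfl, hk⟩
  · have := hcross.symm.mem_Ioo_or_mem_Ioo (c := j) (d := j + m - 1)
      (Finset.mem_Icc.2 (by omega)) (Finset.mem_Icc.2 (by omega))
    unfold shift at *
    grind
  · have := hcross.symm.mem_Ioo_or_mem_Ioo (c := j + 1) (d := j + m)
      (Finset.mem_Icc.2 (by omega)) (Finset.mem_Icc.2 (by omega))
    unfold shift at *
    grind
  · have := hcross.mem_Ioo_or_mem_Ioo (c := 1) (d := j)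
      (Finset.mem_Icc.2 (by unfold shift; grind)) (Finset.mem_Icc.2 (by unfold shift; grind))
    grind

theorem isGluing (h : IsInsertion n m j k g) (hl : l ∈ Finset.Icc 1 n) (hr : r ∈ Finset.Icc 1 m)
    (hkl : IsSide n k l) (hpr : IsSide m 1 r) (hside : IsSide (n + m - 1) (shift m j l) (g r)) :
    IsGluing n m (n + m - 1) (shift m j) g k l 1 r where
  left := .of_strictMonoOn (strictMono_shift.strictMonoOn _)
  right := h.isCyclicEmbedding
  union_eq := h.union_eq (by rw [Finset.mem_Icc] at hr; omega)
  left_mem := ⟨h.mem_right, hl⟩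
  right_mem := ⟨Finset.mem_Icc.2 (by rw [Finset.mem_Icc] at hr; omega), hr⟩
  eq_iff a _ b hb := h.shift_eq_iff hb
  not_crosses a ha b hb c hc d hd := h.not_crosses ha hb hc hd
  left_side := hkl
  right_side := hpr
  side := hside

end IsInsertion

theorem next_prev (hk : k ∈ Finset.Icc 1 n) : next n (prev n k) = k := by
  unfold next prev
  grind

theorem isInsertion_circ (hk : k ∈ Finset.Icc 1 n) :
    IsInsertion n m k k (fun i => k + i - 1) where
  mem := hk
  eq_or_eq := Or.inl rfl
  map_one := (if_pos le_rfl).symm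
  map_of_two_le _ _ := rfl

theorem isInsertion_bullet (hk : k ∈ Finset.Icc 1 n) :
    IsInsertion n m (prev n k) k (bulletLabel n m k) where
  mem := by unfold prev; grind
  eq_or_eq := Or.inr (next_prev hk).symm
  map_one := if_pos rfl
  map_of_two_le i hi := if_neg (by omega)

theorem isGluing_circ (hm : 2 ≤ m) (hk : k ∈ Finset.Icc 1 n) :
    IsGluing n m (n + m - 1) (shift m k) (fun i => k + i - 1) k (next n k) 1 m := by
  have hk' := Finset.mem_Icc.1 hk
  refine (isInsertion_circ hk).isGluing ?_ (Finset.mem_Icc.2 ⟨by omega, le_rfl⟩) (Or.inl rfl)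
    (Or.inr (if_pos rfl)) (Or.inr ?_)
  · unfold next
    grind
  · unfold shift next
    split_ifs <;> omega

theorem isGluing_bullet (hm : 2 ≤ m) (hk : k ∈ Finset.Icc 1 n) :
    IsGluing n m (n + m - 1) (shift m (prev n k)) (bulletLabel n m k) k (prev n k) 1 2 := by
  have hins := isInsertion_bullet (m := m) hk
  refine hins.isGluing hins.mem (Finset.mem_Icc.2 ⟨by omega, hm⟩)
    (Or.inr (next_prev hk)) (Or.inl (if_neg (by omega))) (Or.inl ?_)
  rw [hins.map_of_two_le 2 le_rfl, shift, if_pos le_rfl, next]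
  have := Finset.mem_Icc.1 hins.mem
  split_ifs <;> omega

theorem circ_eq_glue : circ n m k S T =
    glue (shift m k) (fun i => k + i - 1) k (next n k) 1 m S T := by
  rw [circ, glue, Finset.image_insert, Finset.image_insert]
  simp only [Sym2.map_mk, Nat.add_sub_cancel]
  grind

theorem bullet_eq_glue : bullet n m k S T =
    glue (shift m (prev n k)) (bulletLabel n m k) k (prev n k) 1 2 S T := by
  rw [bullet, glue, Finset.image_insert, Finset.image_insert, Sym2.eq_swap]
  simp only [Sym2.map_mk]
  grind

end Products

section QuiddityOfProducts

variable {n m j k l r : ℕ} {g : ℕ → ℕ} {D S T : Finset (Sym2 ℕ)}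

/-- The common form of the products `s ∘ₖ t` and `s •ₖ t` of sequences: `t₂, …, tₘ` is inserted
after position `j` of `s`, `t₁ + 1` is added at `sₖ`, and `1` is added at `sₗ` and at `tᵣ`. -/
def glueSeq (j k l r : ℕ) (s t : List ℕ) : List ℕ :=
  let s' := (s.modify (k - 1) (· + t.headD 0 + 1)).modify (l - 1) (· + 1)
  s'.take j ++ t.tail.modify (r - 2) (· + 1) ++ s'.drop j

theorem length_quiddity : (quiddity n D).length = n := by
  rw [quiddity, List.length_map, List.length_range']

theorem getElem_quiddity {i : ℕ} (hi : i < (quiddity n D).length) :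
    (quiddity n D)[i] = vertexDegree (Edge n D) (Finset.Icc 1 n) (i + 1) := by
  simp only [quiddity_eq_map_vertexDegree, List.getElem_map, List.getElem_range', one_mul,
    add_comm]

theorem headD_quiddity (hn : 1 ≤ n) :
    (quiddity n D).headD 0 = vertexDegree (Edge n D) (Finset.Icc 1 n) 1 := by
  rw [List.headD_eq_head?_getD, List.head?_eq_getElem?,
    List.getElem?_eq_getElem (by rw [length_quiddity]; omega), Option.getD_some, getElem_quiddity]

theorem circSeq_eq_glueSeq : circSeq k (quiddity n S) (quiddity m T) =
    glueSeq k k (next n k) m (quiddity n S) (quiddity m T) := by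
  rw [circSeq, length_quiddity, length_quiddity, glueSeq]

theorem bulletSeq_eq_glueSeq : bulletSeq k (quiddity n S) (quiddity m T) =
    glueSeq (prev n k) k (prev n k) 2 (quiddity n S) (quiddity m T) := by
  rw [bulletSeq, length_quiddity, glueSeq]

namespace IsGluing

theorem getElem_modify_quiddity (h : IsGluing n m (n + m - 1) (shift m j) g k l 1 r)
    (hS : IsDissection n S) (hT : IsDissection m T) {i : ℕ}
    (hi : i < (((quiddity n S).modify (k - 1)
      (· + (quiddity m T).headD 0 + 1)).modify (l - 1) (· + 1)).length) :
    (((quiddity n S).modify (k - 1)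
      (· + (quiddity m T).headD 0 + 1)).modify (l - 1) (· + 1))[i] =
      vertexDegree (Edge (n + m - 1) (glue (shift m j) g k l 1 r S T))
        (Finset.Icc 1 (n + m - 1)) (shift m j (i + 1)) := by
  have hm := hT.three_le
  have hk := Finset.mem_Icc.1 h.left_mem.1
  have hl := Finset.mem_Icc.1 h.left_mem.2
  have hi' : i < n := by simpa only [List.length_modify, length_quiddity] using hi
  rw [h.vertexDegree_glue_left hS hT (Finset.mem_Icc.2 (by omega)), List.getElem_modify,
    List.getElem_modify, getElem_quiddity, headD_quiddity (by omega)]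
  split_ifs <;> omega

theorem quiddity_glue (h : IsGluing n m (n + m - 1) (shift m j) g k l 1 r)
    (hg : IsInsertion n m j k g) (hS : IsDissection n S) (hT : IsDissection m T) :
    quiddity (n + m - 1) (glue (shift m j) g k l 1 r S T) =
      glueSeq j k l r (quiddity n S) (quiddity m T) := by
  have hm := hT.three_le
  have hj := Finset.mem_Icc.1 hg.mem
  have hr := Finset.mem_Icc.1 h.right_mem.2
  have hr₁ := h.right_side.ne (by omega)
  apply List.ext_getElem
  · simp only [glueSeq, List.length_append, List.length_take, List.length_drop,
      List.length_modify, List.length_tail, length_quiddity]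
    omega
  intro i hi hi'
  rw [length_quiddity] at hi
  rw [getElem_quiddity]
  simp only [glueSeq, List.getElem_append, List.length_append, List.length_take,
    List.length_modify, List.length_tail, length_quiddity, List.getElem_take, List.getElem_drop,
    min_eq_left hj.2]
  split_ifs with hij hijm
  · rw [h.getElem_modify_quiddity hS hT, shift, if_pos (by omega)]
  · have hlabel : i + 1 = g (i - j + 1 + 1) := by rw [hg.map_of_two_le _ (by omega)]; omega
    rw [List.getElem_modify, List.getElem_tail, getElem_quiddity, hlabel,
      h.vertexDegree_glue_right hS hT (Finset.mem_Icc.2 (by omega)) (by omega)]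
    split_ifs <;> omega
  · rw [h.getElem_modify_quiddity hS hT, shift, if_neg (by omega)]
    congr 1
    omega

theorem isPositiveSolution_glueSeq (h : IsGluing n m (n + m - 1) (shift m j) g k l 1 r)
    (hg : IsInsertion n m j k g) (hS : Is3dDissection n S) (hT : Is3dDissection m T)
    (heven : Even (index n S + index m T)) :
    IsPositiveSolution (n + m - 1) (glueSeq j k l r (quiddity n S) (quiddity m T)) :=
  h.quiddity_glue hg hS.1 hT.1 ▸ (h.isEven3d_glue hS hT heven).isPositiveSolution_quiddity

/-- At the vertex `shift m j k` the first product has the entry `sₖ + t₁ + 1` or more, the second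
one `sₖ` or `sₖ + 1`, and `t₁` is positive. -/
theorem glueSeq_ne {j' k' l' r' : ℕ} {g' : ℕ → ℕ}
    (h : IsGluing n m (n + m - 1) (shift m j) g k l 1 r) (hg : IsInsertion n m j k g)
    (h' : IsGluing n m (n + m - 1) (shift m j') g' k' l' 1 r') (hg' : IsInsertion n m j' k' g')
    (hS : IsDissection n S) (hT : IsDissection m T) (hk : k ≠ k')
    (hshift : shift m j k = shift m j' k) :
    glueSeq j k l r (quiddity n S) (quiddity m T) ≠
      glueSeq j' k' l' r' (quiddity n S) (quiddity m T) := by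
  have hmem := h.left_mem.1
  have hpos : 0 < vertexDegree (Edge m T) (Finset.Icc 1 m) 1 :=
    hT.isPlanar.vertexDegree_pos (by rw [Nat.card_Icc]; exact hT.three_le) h.right_mem.1
  rw [← h.quiddity_glue hg hS hT, ← h'.quiddity_glue hg' hS hT]
  simp only [quiddity_eq_map_vertexDegree, Ne, List.map_inj_left, List.mem_range'_1]
  intro heq
  have hvertex := heq (shift m j k)
    (by have := Finset.mem_Icc.1 (h.left_map_mem hmem); omega)
  rw [h.vertexDegree_glue_left hS hT hmem, if_pos rfl, hshift,
    h'.vertexDegree_glue_left hS hT hmem, if_neg hk] at hvertex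
  split_ifs at hvertex <;> omega

end IsGluing

theorem injOn_circSeq (hS : IsDissection n S) (hT : IsDissection m T) :
    Set.InjOn (fun k => circSeq k (quiddity n S) (quiddity m T)) (Set.Icc 1 n) := by
  have hm : 2 ≤ m := Nat.le_of_succ_le hT.three_le
  intro k hk k' hk' heq
  by_contra hne
  wlog hlt : k < k' generalizing k k'
  · exact this hk' hk heq.symm (Ne.symm hne) (lt_of_le_of_ne (not_lt.1 hlt) (Ne.symm hne))
  rw [← Finset.coe_Icc, Finset.mem_coe] at hk hk'
  simp only [circSeq_eq_glueSeq] at heq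
  refine (isGluing_circ hm hk).glueSeq_ne (isInsertion_circ hk) (isGluing_circ hm hk')
    (isInsertion_circ hk') hS hT hne ?_ heq
  rw [shift, shift, if_pos le_rfl, if_pos hlt.le]

theorem injOn_bulletSeq (hS : IsDissection n S) (hT : IsDissection m T) :
    Set.InjOn (fun k => bulletSeq k (quiddity n S) (quiddity m T)) (Set.Icc 1 n) := by
  have hm : 2 ≤ m := Nat.le_of_succ_le hT.three_le
  intro k hk k' hk' heq
  by_contra hne
  wlog hlt : k < k' generalizing k k'
  · exact this hk' hk heq.symm (Ne.symm hne) (lt_of_le_of_ne (not_lt.1 hlt) (Ne.symm hne))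
  rw [← Finset.coe_Icc, Finset.mem_coe] at hk hk'
  have hglue := isGluing_bullet hm hk
  have hglue' := isGluing_bullet hm hk'
  have hins := isInsertion_bullet (m := m) hk
  have hins' := isInsertion_bullet (m := m) hk'
  rw [Finset.mem_Icc] at hk hk'
  simp only [bulletSeq_eq_glueSeq] at heq
  by_cases hone : k = 1
  · refine hglue.glueSeq_ne hins hglue' hins' hS hT hne ?_ heq
    unfold shift prev
    split_ifs <;> omega
  · refine hglue'.glueSeq_ne hins' hglue hins hS hT (Ne.symm hne) ?_ heq.symm
    unfold shift prev
    split_ifs <;> omega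

end QuiddityOfProducts

end ThreeD

theorem mainTheorem5 (n m : ℕ) (S T : Finset (Sym2 ℕ))
    (h : (ThreeD.IsEven3d n S ∧ ThreeD.IsEven3d m T) ∨
      (ThreeD.IsOdd3d n S ∧ ThreeD.IsOdd3d m T)) :
    (∀ k ∈ Finset.Icc 1 n,
      (ThreeD.IsEven3d (n + m - 1) (ThreeD.circ n m k S T) ∧
        ThreeD.index (n + m - 1) (ThreeD.circ n m k S T) = ThreeD.index n S + ThreeD.index m T ∧
        ThreeD.quiddity (n + m - 1) (ThreeD.circ n m k S T) =
          ThreeD.circSeq k (ThreeD.quiddity n S) (ThreeD.quiddity m T) ∧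
        ThreeD.IsPositiveSolution (n + m - 1)
          (ThreeD.circSeq k (ThreeD.quiddity n S) (ThreeD.quiddity m T))) ∧
      (ThreeD.IsEven3d (n + m - 1) (ThreeD.bullet n m k S T) ∧
        ThreeD.index (n + m - 1) (ThreeD.bullet n m k S T) = ThreeD.index n S + ThreeD.index m T ∧
        ThreeD.quiddity (n + m - 1) (ThreeD.bullet n m k S T) =
          ThreeD.bulletSeq k (ThreeD.quiddity n S) (ThreeD.quiddity m T) ∧
        ThreeD.IsPositiveSolution (n + m - 1)
          (ThreeD.bulletSeq k (ThreeD.quiddity n S) (ThreeD.quiddity m T)))) ∧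
    Set.InjOn (fun k => ThreeD.circSeq k (ThreeD.quiddity n S) (ThreeD.quiddity m T))
      (Set.Icc 1 n) ∧
    Set.InjOn (fun k => ThreeD.bulletSeq k (ThreeD.quiddity n S) (ThreeD.quiddity m T))
      (Set.Icc 1 n) := by
  obtain ⟨hS, hT, heven⟩ : ThreeD.Is3dDissection n S ∧ ThreeD.Is3dDissection m T ∧
      Even (ThreeD.index n S + ThreeD.index m T) := by
    rcases h with ⟨hS, hT⟩ | ⟨hS, hT⟩
    exacts [⟨hS.1, hT.1, hS.2.add hT.2⟩, ⟨hS.1, hT.1, hS.2.add_odd hT.2⟩]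
  have hm : 2 ≤ m := Nat.le_of_succ_le hT.1.three_le
  refine ⟨fun k hk => ?_, ThreeD.injOn_circSeq hS.1 hT.1, ThreeD.injOn_bulletSeq hS.1 hT.1⟩
  rw [ThreeD.circ_eq_glue, ThreeD.circSeq_eq_glueSeq, ThreeD.bullet_eq_glue,
    ThreeD.bulletSeq_eq_glueSeq]
  have hcirc := ThreeD.isGluing_circ (n := n) hm hk
  have hcirc' := ThreeD.isInsertion_circ (m := m) hk
  have hbullet := ThreeD.isGluing_bullet (n := n) hm hk
  have hbullet' := ThreeD.isInsertion_bullet (m := m) hk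
  exact ⟨⟨hcirc.isEven3d_glue hS hT heven, hcirc.index_glue hS.1 hT.1,
      hcirc.quiddity_glue hcirc' hS.1 hT.1, hcirc.isPositiveSolution_glueSeq hcirc' hS hT heven⟩,
    ⟨hbullet.isEven3d_glue hS hT heven, hbullet.index_glue hS.1 hT.1,
      hbullet.quiddity_glue hbullet' hS.1 hT.1,
      hbullet.isPositiveSolution_glueSeq hbullet' hS hT heven⟩⟩
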